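/- **Setting.** Let $\mathcal Q$ be a CSS code of length $n$ with at least one logical qubit, given by full-rank parity-check matrices $\mathsf H_Z,\mathsf H_X$ of classical codes $\mathcal C_Z,\mathcal C_X$ with $\mathcal C_X^\perp\subseteq\mathcal C_Z$, and suppose that $\mathcal Q$ corrects every Pauli error on at most $t$ qubits. Let $|A\rangle=\sum_{x\in A}|x\rangle$ be a CSS stabilizer state of $\mathcal Q$, where $\mathcal C_X^\perp\subseteq A\subseteq\mathcal C_Z$ ($A=\mathcal C_X^\perp$ is the logical $|0\rangle_L^{\otimes k}$ and $A=\mathcal C_Z$ is the logical $|+\rangle_L^{\otimes k}$). Errors of type $X$ are detected by the $Z$-type stabilizers $Z^s$, $s\in A^\perp$, and errors of type $Z$ by the $X$-type stabilizers $X^s$, $s\in A$. The *complete syndrome* of an error consists of one bit for each element of this group of stabilizers. Errors are identified if they differ by a stabilizer of $|A\rangle$, and the weight of an error is the least weight among the errors so identified. **Sparsity.** Assign to each complete syndrome for errors of type $\tau\in\{X,Z\}$ a least-weight error with that syndrome. $\mathcal Q$ (with $A$, $\tau$) is $\epsilon$-sparse if, for some such assignment, the number of pairs of distinct complete syndromes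 whose errors have intersecting supports, divided by the number of those whose errors have disjoint supports, is less than $\epsilon$. **One round of distillation** for errors of type $\tau$ uses a classical $[n_c,k_c,d_c]$ code $\mathcal C_c$, $k_c>0$, with parity-check matrix $[\mathsf I\,|\,\mathsf A_c]$, and a syndrome decoder for it that corrects all patterns of at most $t_c=\lfloor (d_c-1)/2\rfloor$ errors. The inputs are $n_c$ independently and identically prepared blocks. The first $r_c=n_c-k_c$ are check blocks, the others are output blocks. For each $[\mathsf A_c]_{i,j}=1$ a transversal CNOT is applied between output block $j$ and check block $i$ (the check block is the target if $\tau=X$, and the control if $\tau=Z$), in any temporal order, and then all qubits of the check blocks are measured (in the $Z$ basis if $\tau=X$, in the $X$ basis if $\tau=Z$). For every stabilizer $s$ that detects errors of type $\tau$, the parities of the $r_c$ measured strings on $s$ are decoded by $\mathcal C_c$, which gives the estimated bit of $s$ on each block. In *ideal postselection*, an output block is kept if and only if its estimated complete syndrome is valid, that is, compatible with products of stabilizers; a recovery for the estimated syndrome is then applied. The inputs are either fresh blocks, each encoded by the same noisy circuit (physical $|0\rangle$ and $|+\rangle$ states followed by CNOT gates), or blocks that were kept as outputs of independent such rounds for the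 opposite error type, run on fresh blocks. **Noise.** All CNOT gates, in encoding and in distillation, and all measurements fail independently with probability $p$; a failing CNOT gate is followed by one of the 15 nontrivial two-qubit Pauli operators, each equally likely, and a failing measurement flips its outcome bit. **Qualified.** An output block is *qualified* if it is free of correlated errors of type $\tau$: each error $E$ of type $\tau$ remains on it, given that it is kept, with probability $O(p^{\min(\mathrm{wt}(E),t)})$ as $p\to0$. It is *qualified with probability at least $\theta$* if there is an event that has probability at least $\theta$ given that the block is kept, also when one conditions further on the number of failures, such that for each $E$ the probability that $E$ remains and the event occurs, given that the block is kept, is $O(p^{\min(\mathrm{wt}(E),t)})$ as $p\to0$. **Theorem.** There is a universal constant $K\ge0$ such that the following holds. Suppose that $\mathcal Q$ is $\epsilon$-sparse for errors of type $\tau$. For a round of distillation for errors of type $\tau$ as above, the classical code $\mathcal C_c$ satisfies $t_c\ge t-1$ if and only if, for every encoding circuit for $|A\rangle$, every output block is, after ideal postselection, qualified with probability at least $1-K\epsilon$ in the regime of sufficiently small failure rate $p$ (the limit $p\to0$ in the definition above). -/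

import Mathlib

namespace AncillaDistillation

open Matrix Filter Topology Asymptotics

/-! ### Pauli operators in binary representation -/

/-- Binary vectors indexed by `q`. -/
abbrev BinVec (q : Type) : Type := q → ZMod 2

/-- The binary representation `(e, f)` of the Pauli operator `X^e Z^f` (phases are irrelevant). -/
abbrev Pauli (q : Type) : Type := BinVec q × BinVec q

/-- Number of qubits on which a Pauli operator acts nontrivially. -/
def pauliWeight {n : ℕ} (E : Pauli (Fin n)) : ℕ :=
  (Finset.univ.filter fun i => E.1 i ≠ 0 ∨ E.2 i ≠ 0).card

/-- The two types of errors. -/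
inductive ErrorType : Type
  | X : ErrorType
  | Z : ErrorType

namespace ErrorType

/-- The opposite type. -/
def swap : ErrorType → ErrorType
  | X => Z
  | Z => X

/-- The `X` part, respectively `Z` part, of a Pauli operator. -/
def part {q : Type} : ErrorType → Pauli q → BinVec q
  | X, E => E.1
  | Z, E => E.2

/-- The Pauli operator of pure type `τ` with binary vector `v`. -/
def toPauli {q : Type} : ErrorType → BinVec q → Pauli q
  | X, v => (v, 0)
  | Z, v => (0, v)

end ErrorType

/-! ### CSS codes and their stabilizer states -/

/-- The dual of a binary linear code. -/
def dualCode {n : ℕ} (A : Submodule (ZMod 2) (BinVec (Fin n))) :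
    Submodule (ZMod 2) (BinVec (Fin n)) where
  carrier := {z | ∀ x ∈ A, x ⬝ᵥ z = 0}
  zero_mem' := fun x _ => by simp
  add_mem' := fun {a b} ha hb x hx => by
    rw [dotProduct_add, ha x hx, hb x hx, add_zero]
  smul_mem' := fun c a ha x hx => by
    rw [dotProduct_smul, ha x hx, smul_zero]

/-- A CSS code of length `n` with at least one logical qubit: full-rank parity-check matrices
`HZ` of `C_Z` and `HX` of `C_X` such that `C_X^⊥ ⊆ C_Z`. The rows of `HZ` (`HX`) are the
`Z`-type (`X`-type) stabilizer generators; the number of logical qubits is `n - rZ - rX`. -/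
structure CSSCode (n : ℕ) where
  rZ : ℕ
  rX : ℕ
  HZ : Matrix (Fin rZ) (Fin n) (ZMod 2)
  HX : Matrix (Fin rX) (Fin n) (ZMod 2)
  rankZ : LinearIndependent (ZMod 2) HZ.row
  rankX : LinearIndependent (ZMod 2) HX.row
  orthogonal : HZ * HXᵀ = 0
  logical_pos : rZ + rX < n

namespace CSSCode

variable {n : ℕ} (Q : CSSCode n)

/-- `C_X^⊥`: the binary vectors of the `X`-type stabilizers. -/
def stabX : Submodule (ZMod 2) (BinVec (Fin n)) :=
  Submodule.span (ZMod 2) (Set.range Q.HX.row)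

/-- `C_Z^⊥`: the binary vectors of the `Z`-type stabilizers. -/
def stabZ : Submodule (ZMod 2) (BinVec (Fin n)) :=
  Submodule.span (ZMod 2) (Set.range Q.HZ.row)

/-- `X^e Z^f` has trivial error syndrome. -/
def Undetected (E : Pauli (Fin n)) : Prop :=
  Q.HZ *ᵥ E.1 = 0 ∧ Q.HX *ᵥ E.2 = 0

/-- `X^e Z^f` is a stabilizer up to phase. -/
def IsStabilizer (E : Pauli (Fin n)) : Prop :=
  E.1 ∈ Q.stabX ∧ E.2 ∈ Q.stabZ

/-- The code can correct every Pauli error on at most `t` qubits: two such errors with the same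
syndrome differ by a stabilizer. -/
def Corrects (t : ℕ) : Prop :=
  ∀ E E' : Pauli (Fin n), pauliWeight E ≤ t → pauliWeight E' ≤ t →
    Q.Undetected (E + E') → Q.IsStabilizer (E + E')

/-- A CSS stabilizer state of `Q` on one block, `∑_{x ∈ A} |x⟩` (unnormalised), where
`C_X^⊥ ⊆ A ⊆ C_Z`. Its `X`-type stabilizers are the `X^x` with `x ∈ A` and its `Z`-type
stabilizers are the `Z^z` with `z ∈ A^⊥`; they include the stabilizers of `Q`.
`A = C_X^⊥` is the logical `|0…0⟩`, and `A = C_Z` is the logical `|+…+⟩`. -/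
structure Ancilla where
  A : Submodule (ZMod 2) (BinVec (Fin n))
  stabX_le : Q.stabX ≤ A
  le_codeZ : ∀ x ∈ A, Q.HZ *ᵥ x = 0

end CSSCode

section Syndromes

variable {n : ℕ} (τ : ErrorType) (A : Submodule (ZMod 2) (BinVec (Fin n)))

/-- The stabilizers of the state `∑_{x ∈ A} |x⟩` that detect errors of type `τ` (all elements of
the group, not only generators): `Z`-type stabilizers for `X` errors and vice versa. -/
def checkGroup : ErrorType → Submodule (ZMod 2) (BinVec (Fin n))
  | ErrorType.X => dualCode A
  | ErrorType.Z => A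

/-- The errors of type `τ` that act trivially on the state `∑_{x ∈ A} |x⟩`: its stabilizers of
type `τ`. -/
def trivialGroup : ErrorType → Submodule (ZMod 2) (BinVec (Fin n))
  | ErrorType.X => A
  | ErrorType.Z => dualCode A

/-- The complete syndrome of an error of type `τ`: one bit for each element of the group of
stabilizers that detect errors of type `τ`. -/
def completeSyndrome (e : BinVec (Fin n)) : ↥(checkGroup A τ) → ZMod 2 :=
  fun s => (s : BinVec (Fin n)) ⬝ᵥ e

/-- The weight of an error of type `τ` on the state `∑_{x ∈ A} |x⟩`: the least weight of an error
of that type with the same effect on the state. -/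
noncomputable def errorWeight (e : BinVec (Fin n)) : ℕ :=
  sInf {w | ∃ a ∈ trivialGroup A τ, w = hammingNorm (e + a)}

/-- The set of qubits on which an error acts. -/
def errorSupport (e : BinVec (Fin n)) : Set (Fin n) := {i | e i ≠ 0}

/-- `ε`-sparsity: assign to each complete syndrome a least-weight error having that syndrome;
among the pairs of distinct complete syndromes, the number of those whose errors have intersecting
supports, divided by the number of those whose errors have disjoint supports, is below `ε`. -/
def IsSparse (ε : ℝ) : Prop :=
  ∃ L : (↥(checkGroup A τ) → ZMod 2) → BinVec (Fin n),
    (∀ e : BinVec (Fin n),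
      completeSyndrome τ A (L (completeSyndrome τ A e)) = completeSyndrome τ A e ∧
      hammingNorm (L (completeSyndrome τ A e)) ≤ hammingNorm e) ∧
    ({c : (↥(checkGroup A τ) → ZMod 2) × (↥(checkGroup A τ) → ZMod 2) |
        c.1 ∈ Set.range (completeSyndrome τ A) ∧ c.2 ∈ Set.range (completeSyndrome τ A) ∧
        c.1 ≠ c.2 ∧ ¬ Disjoint (errorSupport (L c.1)) (errorSupport (L c.2))}.ncard : ℝ) /
      ({c : (↥(checkGroup A τ) → ZMod 2) × (↥(checkGroup A τ) → ZMod 2) |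
        c.1 ∈ Set.range (completeSyndrome τ A) ∧ c.2 ∈ Set.range (completeSyndrome τ A) ∧
        c.1 ≠ c.2 ∧ Disjoint (errorSupport (L c.1)) (errorSupport (L c.2))}.ncard : ℝ) < ε

end Syndromes

/-! ### Noisy CNOT circuits -/

section Circuits

variable {q : Type} [DecidableEq q]

/-- The Pauli operator following a CNOT gate: (`X` bit, `Z` bit) on the control qubit and on the
target qubit. `0` means that the gate does not fail; the other 15 values are the failures. -/
abbrev GateFailure : Type := (ZMod 2 × ZMod 2) × (ZMod 2 × ZMod 2)

/-- Conjugation of a Pauli operator by the CNOT gate with control `g.1` and target `g.2`. -/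
def conjCNOT (g : q × q) (E : Pauli q) : Pauli q :=
  (Function.update E.1 g.2 (E.1 g.2 + E.1 g.1), Function.update E.2 g.1 (E.2 g.1 + E.2 g.2))

/-- Multiplication by the failure `φ` of the gate `g`. -/
def applyFailure (g : q × q) (φ : GateFailure) (E : Pauli q) : Pauli q :=
  E + (Pi.single g.1 φ.1.1 + Pi.single g.2 φ.2.1, Pi.single g.1 φ.1.2 + Pi.single g.2 φ.2.2)

/-- Propagation of a Pauli error through a CNOT circuit (gates in temporal order), each gate being
followed by its failure. -/
def propagate : (gates : List (q × q)) → (Fin gates.length → GateFailure) → Pauli q → Pauli q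
  | [], _, E => E
  | g :: gs, φ, E =>
      propagate gs (fun i => φ i.succ) (applyFailure g (φ 0) (conjCNOT g E))

/-- The action `|x⟩ ↦ |T x⟩` of a noiseless CNOT circuit on computational basis states. -/
def basisAction (gates : List (q × q)) (x : BinVec q) : BinVec q :=
  gates.foldl (fun y g => Function.update y g.2 (y g.2 + y g.1)) x

end Circuits

/-- An encoding circuit for the state `∑_{x ∈ A} |x⟩`: the qubits in `plus` start in `|+⟩` and the
others in `|0⟩`, and CNOT gates follow; without failures, the initial state, which is the uniform
superposition of the `|x⟩` with `x` supported on `plus`, becomes `∑_{x ∈ A} |x⟩`. -/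
structure EncodingCircuit {n : ℕ} (A : Submodule (ZMod 2) (BinVec (Fin n))) where
  plus : Finset (Fin n)
  gates : List (Fin n × Fin n)
  control_ne_target : ∀ g ∈ gates, g.1 ≠ g.2
  prepares : basisAction gates '' {x | ∀ i, i ∉ plus → x i = 0} = (A : Set (BinVec (Fin n)))

/-! ### Noisy procedures with postselection -/

/-- A noisy procedure that outputs one block of `n` qubits: finitely many places where a CNOT gate
can fail and finitely many places where a measurement can fail, the residual Pauli error on the
output block, and whether the output block is kept, as functions of the failures. -/
structure Procedure (n : ℕ) where
  Gate : Type
  Meas : Type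
  [gateFintype : Fintype Gate]
  [measFintype : Fintype Meas]
  error : (Gate → GateFailure) × (Meas → ZMod 2) → Pauli (Fin n)
  Accepted : (Gate → GateFailure) × (Meas → ZMod 2) → Prop

namespace Procedure

attribute [instance] Procedure.gateFintype Procedure.measFintype

variable {n : ℕ} (P : Procedure n)

/-- A pattern of failures (`0` at a place: no failure there). -/
abbrev Pattern : Type := (P.Gate → GateFailure) × (P.Meas → ZMod 2)

/-- The number of failures in a pattern. -/
noncomputable def numFailures (ω : P.Pattern) : ℕ :=
  {g | ω.1 g ≠ 0}.ncard + {m | ω.2 m ≠ 0}.ncard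

/-- The probability of a failure pattern: gates and measurements fail independently with
probability `p`, and the 15 failures of a gate are equally likely. -/
noncomputable def weight (p : ℝ) (ω : P.Pattern) : ℝ :=
  (∏ g, if ω.1 g = 0 then 1 - p else p / 15) * ∏ m, if ω.2 m = 0 then 1 - p else p

open Classical in
/-- The probability of a set of failure patterns. -/
noncomputable def prob (p : ℝ) (S : Set P.Pattern) : ℝ :=
  ∑ ω : P.Pattern, if ω ∈ S then P.weight p ω else 0

/-- The event that the output block is kept. -/
def acceptEvent : Set P.Pattern := {ω | P.Accepted ω}

variable (τ : ErrorType) (A : Submodule (ZMod 2) (BinVec (Fin n))) (t : ℕ)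

/-- The event that the residual error of type `τ` on the output block is `e`, up to errors that act
trivially on the state. -/
def residualEvent (e : BinVec (Fin n)) : Set P.Pattern :=
  {ω | τ.part (P.error ω) + e ∈ trivialGroup A τ}

/-- Within the event `U`, the output block is free of correlated errors of type `τ`: each error `e`
occurs, given that the block is kept, with probability `O(p ^ s)` as `p → 0`, where `s` is the
weight of `e` if that is at most `t`, and `s = t` otherwise. -/
def QualifiedOn (U : Set P.Pattern) : Prop :=
  ∀ e : BinVec (Fin n),
    (fun p : ℝ => P.prob p (U ∩ P.acceptEvent ∩ P.residualEvent τ A e) / P.prob p P.acceptEvent)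
      =O[𝓝[>] 0] fun p : ℝ => p ^ min (errorWeight τ A e) t

/-- The output block, if kept, is qualified for errors of type `τ` with probability at least `θ`:
it is qualified within an event that, given that the block is kept, has probability at least `θ`.
This is required conditionally on each number `ℓ` of failures (it follows without the condition):
as `p → 0` runs without any failure dominate, so that the unconditional requirement alone would
be met by the event of no failure. -/
def QualifiedWithProb (θ : ℝ) : Prop :=
  ∃ U : Set P.Pattern,
    (∀ (ℓ : ℕ) (p : ℝ), 0 < p → p < 1 →
      θ * P.prob p (P.acceptEvent ∩ {ω | P.numFailures ω = ℓ}) ≤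
        P.prob p (U ∩ P.acceptEvent ∩ {ω | P.numFailures ω = ℓ})) ∧
    P.QualifiedOn τ A t U

end Procedure

/-- Preparation of one block by a noisy encoding circuit; no block is discarded. -/
def EncodingCircuit.procedure {n : ℕ} {A : Submodule (ZMod 2) (BinVec (Fin n))}
    (P : EncodingCircuit A) : Procedure n where
  Gate := Fin P.gates.length
  Meas := Empty
  error := fun ω => propagate P.gates ω.1 0
  Accepted := fun _ => True

/-! ### Classical codes and a round of distillation -/

/-- A classical binary linear code with systematic parity-check matrix `[I | M]`, of length `r + k`
and dimension `k > 0`. Coordinates: `r` check positions, then `k` further positions. -/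
structure ClassicalCode where
  r : ℕ
  k : ℕ
  M : Matrix (Fin r) (Fin k) (ZMod 2)
  k_pos : 0 < k

namespace ClassicalCode

variable (C : ClassicalCode)

/-- Index set of the coordinates of the code, and of the blocks in a round of distillation. -/
abbrev Pos : Type := Fin C.r ⊕ Fin C.k

/-- The parity-check matrix `[I | M]`. -/
def H : Matrix (Fin C.r) C.Pos (ZMod 2) := Matrix.fromCols 1 C.M

/-- The minimum distance `d`. -/
noncomputable def minDist : ℕ := sInf {w | ∃ v : BinVec C.Pos, v ≠ 0 ∧ C.H *ᵥ v = 0 ∧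
  w = hammingNorm v}

/-- The number `⌊(d - 1) / 2⌋` of errors that the code can correct. -/
noncomputable def numCorrectable : ℕ := (C.minDist - 1) / 2

end ClassicalCode

/-- The data of a round of distillation that removes errors of type `τ` from blocks in the state
`∑_{x ∈ A} |x⟩`:
* a classical code, with a syndrome decoder that corrects all errors that the code can correct;
* a temporal order of the CNOT gates of the distillation circuit, one gate `(i, j, a)` for each
  entry `M i j = 1` and each `a`, between qubit `a` of check block `i` and qubit `a` of block `j`;
* a recovery map, from syndromes to errors of type `τ` having that syndrome. -/
structure Round {n : ℕ} (τ : ErrorType) (A : Submodule (ZMod 2) (BinVec (Fin n))) where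
  code : ClassicalCode
  decoder : BinVec (Fin code.r) → BinVec code.Pos
  decoder_corrects : ∀ v : BinVec code.Pos, hammingNorm v ≤ code.numCorrectable →
    decoder (code.H *ᵥ v) = v
  schedule : List (Fin code.r × Fin code.k × Fin n)
  schedule_nodup : schedule.Nodup
  mem_schedule : ∀ i j a, (i, j, a) ∈ schedule ↔ code.M i j = 1
  recovery : (↥(checkGroup A τ) → ZMod 2) → BinVec (Fin n)
  recovery_spec : ∀ e : BinVec (Fin n),
    completeSyndrome τ A (recovery (completeSyndrome τ A e)) = completeSyndrome τ A e

namespace Round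

variable {n : ℕ} {τ : ErrorType} {A : Submodule (ZMod 2) (BinVec (Fin n))} (R : Round τ A)

/-- The qubits of the round: the check blocks, then the output blocks. -/
abbrev Qubit : Type := R.code.Pos × Fin n

/-- Control and target of a scheduled gate. To remove `X` errors the check blocks are the targets;
to remove `Z` errors they are the controls. -/
def gateOf (τ : ErrorType) (g : Fin R.code.r × Fin R.code.k × Fin n) : R.Qubit × R.Qubit :=
  match τ with
  | ErrorType.X => ((Sum.inr g.2.1, g.2.2), (Sum.inl g.1, g.2.2))
  | ErrorType.Z => ((Sum.inl g.1, g.2.2), (Sum.inr g.2.1, g.2.2))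

/-- The transversal CNOT gates of the distillation circuit, in temporal order. -/
def gates : List (R.Qubit × R.Qubit) := R.schedule.map (R.gateOf τ)

variable (inp : R.code.Pos → Procedure n)

/-- The places where a gate can fail: in the preparation of the input blocks, or in the
distillation circuit. -/
abbrev GateLoc : Type := (Σ b : R.code.Pos, (inp b).Gate) ⊕ Fin R.gates.length

/-- The places where a measurement can fail: in the preparation of the input blocks, or in the
measurement of the qubits of the check blocks. -/
abbrev MeasLoc : Type := (Σ b : R.code.Pos, (inp b).Meas) ⊕ (Fin R.code.r × Fin n)

/-- A pattern of failures in the round, including the preparation of its input blocks. -/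
abbrev Pattern : Type := (R.GateLoc inp → GateFailure) × (R.MeasLoc inp → ZMod 2)

variable {inp}

/-- The failures in the preparation of the input block `b`. -/
def inputPattern (ω : R.Pattern inp) (b : R.code.Pos) : (inp b).Pattern :=
  (fun g => ω.1 (Sum.inl ⟨b, g⟩), fun m => ω.2 (Sum.inl ⟨b, m⟩))

/-- The errors on all blocks before the distillation circuit. -/
def inputError (ω : R.Pattern inp) : Pauli R.Qubit :=
  (fun a => ((inp a.1).error (R.inputPattern ω a.1)).1 a.2,
   fun a => ((inp a.1).error (R.inputPattern ω a.1)).2 a.2)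

/-- The errors on all blocks after the noisy distillation circuit, before the measurements. -/
def circuitError (ω : R.Pattern inp) : Pauli R.Qubit :=
  propagate R.gates (fun i => ω.1 (Sum.inr i)) (R.inputError ω)

/-- The bits flipped in the bitwise measurement (`Z` basis if `τ = X`, `X` basis if `τ = Z`) of
check block `i`, relative to an error-free run. An error-free run yields a random vector orthogonal
to all checks, so that these flips determine all measured parities. -/
def measuredFlips (ω : R.Pattern inp) (i : Fin R.code.r) : BinVec (Fin n) :=
  fun a => τ.part (R.circuitError ω) (Sum.inl i, a) + ω.2 (Sum.inr (i, a))

/-- The estimated complete syndrome of output block `j`: for each stabilizer `s`, the parities of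
the measured check blocks on `s` are decoded by the classical code. -/
def estimate (ω : R.Pattern inp) (j : Fin R.code.k) : ↥(checkGroup A τ) → ZMod 2 :=
  fun s => R.decoder (fun i => (s : BinVec (Fin n)) ⬝ᵥ R.measuredFlips ω i) (Sum.inr j)

/-- The estimated complete syndrome of output block `j` is valid: the estimated bits are compatible
with products of stabilizers. -/
def Valid (ω : R.Pattern inp) (j : Fin R.code.k) : Prop :=
  ∀ s s' : ↥(checkGroup A τ), R.estimate ω j (s + s') = R.estimate ω j s + R.estimate ω j s'

variable (inp)

/-- Output block `j` of the round with ideal postselection: it is kept if and only if all input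
blocks were kept and its estimated complete syndrome is valid, and then the recovery for the
estimated syndrome is applied. -/
def output (j : Fin R.code.k) : Procedure n where
  Gate := R.GateLoc inp
  Meas := R.MeasLoc inp
  error := fun ω =>
    ((fun a => (R.circuitError ω).1 (Sum.inr j, a)),
      (fun a => (R.circuitError ω).2 (Sum.inr j, a))) +
    τ.toPauli (R.recovery (R.estimate ω j))
  Accepted := fun ω => (∀ b, (inp b).Accepted (R.inputPattern ω b)) ∧ R.Valid ω j

end Round

end AncillaDistillation

open AncillaDistillation

/-!
The equivalence holds with `K = 0`: the kept blocks are qualified with certainty, or some encoding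
circuit makes an output block fail to be qualified.

*Sufficiency* (`Round.qualifiedWithProb_of_le`). It suffices that `ℓ < t` failures leave an error
of weight at most `ℓ` on a kept block, since patterns of `t` or more failures have total probability
`O(p ^ t)` and the block is kept with probability bounded away from `0`
(`Procedure.qualifiedWithProb_one`). A failure in the preparation of the inputs damages one block,
possibly on all its qubits; a failure of a transversal gate or of a measurement in the round touches
one qubit `a`, the same in all blocks. Let `F` be the set of these qubits, so that `|F| ≤ ℓ`. For a
stabilizer `s` that vanishes on `F`, the measured parities form the classical syndrome of the bits
of `s` on the inputs, and these bits are nonzero on at most `ℓ ≤ t - 1 ≤ t_c` blocks. The bits of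
such `s` are hence estimated correctly. Nothing is known about the other stabilizers, but a
valid syndrome is linear in `s`, and two linear syndromes that agree on all `s` vanishing on `F`
differ by the syndrome of an error supported on `F`. So the residual error is equivalent to one
supported on `F` (`Round.exists_residual_supported`).

*Necessity* (`Round.le_of_qualifiedWithProb`). Halving a codeword of least weight gives a pattern
`v` of at most `t_c + 1` blocks that the decoder misjudges on some output block
(`ClassicalCode.exists_decoder_ne`). Put one and the same error `e` on the blocks of `v`. A
stabilizer sees the classical pattern `v` or `0`, so that the estimated syndrome is a multiple of
the syndrome of `e`, thus valid, and the misjudged block is kept with the error `e`. There is such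
an `e` of weight `t` on the state: `t` qubits of a logical operator of least weight
(`CSSCode.Ancilla.exists_heavy_error`). Some encoding circuit produces it by a single
failure (`exists_encodingCircuit_fault`). The error then has probability of order
`p ^ (t_c + 1)` at least, which is `O(p ^ t)` only if `t ≤ t_c + 1`.

A round for the opposite error type transmits an error of type `τ` on one of its output blocks
unchanged (`Round.output_of_opposite`), so that both arguments apply to its outputs as inputs.
-/

namespace AncillaDistillation

open Matrix Filter Topology Asymptotics

variable {n : ℕ}

/-! ### Binary linear algebra -/

theorem zmod_two_eq_one {c : ZMod 2} (h : c ≠ 0) : c = 1 := by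
  revert c; decide

theorem binVec_add_self {q : Type} (v : BinVec q) : v + v = 0 := by
  funext i
  exact CharTwo.add_self_eq_zero _

theorem exists_dotProduct_eq {q : Type} [Fintype q] (f : BinVec q →ₗ[ZMod 2] ZMod 2) :
    ∃ z : BinVec q, ∀ x, f x = x ⬝ᵥ z := by
  classical
  refine ⟨fun i => f (Pi.single i 1), fun x => ?_⟩
  rw [LinearMap.pi_apply_eq_sum_univ f x, dotProduct]
  refine Finset.sum_congr rfl fun i _ => ?_
  rw [smul_eq_mul]
  congr 2
  funext j
  simp [Pi.single_apply, eq_comm]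

theorem mem_of_forall_dualCode (A : Submodule (ZMod 2) (BinVec (Fin n))) {x : BinVec (Fin n)}
    (h : ∀ z ∈ dualCode A, z ⬝ᵥ x = 0) : x ∈ A := by
  by_contra hx
  obtain ⟨f, hfx, hf⟩ := Submodule.exists_le_ker_of_notMem hx
  obtain ⟨z, hz⟩ := exists_dotProduct_eq f
  refine hfx ?_
  rw [hz, dotProduct_comm]
  refine h z fun y hy => ?_
  rw [← hz]
  exact hf hy

theorem mem_trivialGroup_iff (τ : ErrorType) (A : Submodule (ZMod 2) (BinVec (Fin n)))
    (e : BinVec (Fin n)) :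
    e ∈ trivialGroup A τ ↔ ∀ s ∈ checkGroup A τ, s ⬝ᵥ e = 0 := by
  cases τ
  · refine ⟨fun he s hs => ?_, fun h => mem_of_forall_dualCode A h⟩
    rw [dotProduct_comm]
    exact hs e he
  · exact Iff.rfl

theorem add_mem_trivialGroup_of_syndrome_eq {τ : ErrorType}
    {A : Submodule (ZMod 2) (BinVec (Fin n))} {e e' : BinVec (Fin n)}
    (h : completeSyndrome τ A e = completeSyndrome τ A e') : e + e' ∈ trivialGroup A τ := by
  rw [mem_trivialGroup_iff]
  intro s hs
  have := congrFun h ⟨s, hs⟩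
  simp only [completeSyndrome] at this
  rw [dotProduct_add, this, CharTwo.add_self_eq_zero]

/-- A syndrome whose bits are compatible with products of stabilizers is the syndrome of some
error. -/
theorem exists_error_of_additive {B : Submodule (ZMod 2) (BinVec (Fin n))} {f : B → ZMod 2}
    (hf : ∀ s s', f (s + s') = f s + f s') :
    ∃ e : BinVec (Fin n), ∀ s : B, f s = (s : BinVec (Fin n)) ⬝ᵥ e := by
  obtain ⟨g, hg⟩ := LinearMap.exists_extend ((AddMonoidHom.mk' f hf).toZModLinearMap 2)
  obtain ⟨e, he⟩ := exists_dotProduct_eq g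
  refine ⟨e, fun s => ?_⟩
  rw [← he]
  exact (LinearMap.congr_fun hg s).symm

/-- An error that is orthogonal to all checks vanishing on a set `F` of qubits is equivalent, as
far as the checks can tell, to an error supported on `F`. -/
theorem exists_supported_of_orthogonal (B : Submodule (ZMod 2) (BinVec (Fin n)))
    (F : Finset (Fin n)) (ρ : BinVec (Fin n))
    (h : ∀ s ∈ B, (∀ a ∈ F, s a = 0) → s ⬝ᵥ ρ = 0) :
    ∃ g : BinVec (Fin n), (∀ a, a ∉ F → g a = 0) ∧ ∀ s ∈ B, s ⬝ᵥ (ρ + g) = 0 := by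
  let L : F → B →ₗ[ZMod 2] ZMod 2 := fun a => (LinearMap.proj (a : Fin n)).comp B.subtype
  let K : B →ₗ[ZMod 2] ZMod 2 :=
    { toFun := fun s => (s : BinVec (Fin n)) ⬝ᵥ ρ
      map_add' := fun s s' => by simp [add_dotProduct]
      map_smul' := fun c s => by simp [smul_dotProduct] }
  have hK : K ∈ Submodule.span (ZMod 2) (Set.range L) := by
    refine mem_span_of_iInf_ker_le_ker fun s hs => ?_
    simp only [Submodule.mem_iInf, LinearMap.mem_ker] at hs ⊢
    exact h s s.2 fun a ha => hs ⟨a, ha⟩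
  obtain ⟨c, hc⟩ := (Submodule.mem_span_range_iff_exists_fun (ZMod 2)).1 hK
  refine ⟨fun a => if ha : a ∈ F then c ⟨a, ha⟩ else 0, fun a ha => dif_neg ha, fun s hs => ?_⟩
  have h1 : s ⬝ᵥ ρ = ∑ a : F, c a * s a := by
    have := LinearMap.congr_fun hc ⟨s, hs⟩
    simp only [LinearMap.sum_apply, LinearMap.smul_apply, smul_eq_mul] at this
    exact this.symm
  have h2 : (s ⬝ᵥ fun a => if ha : a ∈ F then c ⟨a, ha⟩ else 0) = ∑ a : F, c a * s a := by
    rw [dotProduct, ← Finset.sum_subset (Finset.subset_univ F), ← Finset.sum_coe_sort]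
    · exact Finset.sum_congr rfl fun a _ => by simp [mul_comm]
    · intro a _ ha
      simp [ha]
  rw [dotProduct_add, h1, h2, CharTwo.add_self_eq_zero]

theorem errorWeight_le {τ : ErrorType} {A : Submodule (ZMod 2) (BinVec (Fin n))}
    {e g : BinVec (Fin n)} (h : e + g ∈ trivialGroup A τ) : errorWeight τ A e ≤ hammingNorm g := by
  refine Nat.sInf_le ⟨e + g, h, ?_⟩
  rw [← add_assoc, binVec_add_self, zero_add]

theorem le_errorWeight {τ : ErrorType} {A : Submodule (ZMod 2) (BinVec (Fin n))}
    {e : BinVec (Fin n)} {t : ℕ} (h : ∀ a ∈ trivialGroup A τ, t ≤ hammingNorm (e + a)) :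
    t ≤ errorWeight τ A e := by
  refine le_csInf ⟨_, 0, Submodule.zero_mem _, rfl⟩ ?_
  rintro w ⟨a, ha, rfl⟩
  exact h a ha

/-- Any binary vector splits along its support into vectors of prescribed weights. -/
theorem exists_add_eq_hammingNorm {q : Type} [Fintype q] (v : BinVec q) {m : ℕ}
    (hm : m ≤ hammingNorm v) :
    ∃ e e' : BinVec q, e + e' = v ∧ hammingNorm e = m ∧ hammingNorm e' = hammingNorm v - m := by
  classical
  obtain ⟨T, hT, rfl⟩ := Finset.exists_subset_card_eq hm
  have hT' : ∀ i ∈ T, v i ≠ 0 := fun i hi => (Finset.mem_filter.1 (hT hi)).2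
  refine ⟨fun i => if i ∈ T then v i else 0, fun i => if i ∈ T then 0 else v i, ?_, ?_, ?_⟩
  · funext i
    by_cases hi : i ∈ T <;> simp [hi]
  · unfold hammingNorm
    congr 1
    ext i
    by_cases hi : i ∈ T <;> simp [hi, hT']
  · rw [hammingNorm, hammingNorm, ← Finset.card_sdiff_of_subset hT]
    congr 1
    ext i
    by_cases hi : i ∈ T <;> simp [hi]

theorem hammingNorm_add_le {q : Type} [Fintype q] (v w : BinVec q) :
    hammingNorm (v + w) ≤ hammingNorm v + hammingNorm w := by
  classical
  unfold hammingNorm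
  refine (Finset.card_le_card fun i hi => ?_).trans (Finset.card_union_le _ _)
  simp only [Finset.mem_filter, Finset.mem_univ, true_and, Finset.mem_union, Pi.add_apply]
    at hi ⊢
  by_contra! hc
  exact hi (by rw [hc.1, hc.2, add_zero])

/-! ### Errors of maximal weight that a CSS code can correct -/

theorem exists_mem_ker_notMem {r : ℕ} (H : Matrix (Fin r) (Fin n) (ZMod 2))
    (W : Submodule (ZMod 2) (BinVec (Fin n))) (h : r + Module.finrank (ZMod 2) W < n) :
    ∃ x, H *ᵥ x = 0 ∧ x ∉ W := by
  by_contra! hc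
  have h1 := LinearMap.finrank_range_add_finrank_ker H.mulVecLin
  have h2 : LinearMap.ker H.mulVecLin ≤ W := fun x hx => hc x (by simpa using hx)
  have h3 := Submodule.finrank_mono h2
  have h4 := Submodule.finrank_le (LinearMap.range H.mulVecLin)
  rw [Module.finrank_fintype_fun_eq_card, Fintype.card_fin] at h1 h4
  exact absurd h (not_lt.2 (h1.symm.le.trans (add_le_add h4 h3)))

theorem pauliWeight_toPauli (τ : ErrorType) (v : BinVec (Fin n)) :
    pauliWeight (τ.toPauli v) = hammingNorm v := by
  cases τ <;> simp [pauliWeight, ErrorType.toPauli, hammingNorm]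

/-- Half of a logical operator of least weight: let `W` be the stabilizers of a type and `N ⊇ W`
the undetected operators of that type. If `N` has no element outside `W` that is a sum of two
vectors of weight at most `t`, then there is a vector of weight `t` that no element of `N` makes
lighter. -/
theorem exists_heavy_of_correctable {N W : Submodule (ZMod 2) (BinVec (Fin n))} {t : ℕ}
    (hne : ∃ x ∈ N, x ∉ W)
    (hcor : ∀ e e' : BinVec (Fin n), hammingNorm e ≤ t → hammingNorm e' ≤ t →
      e + e' ∈ N → e + e' ∈ W) :
    ∃ e : BinVec (Fin n), hammingNorm e = t ∧ ∀ a ∈ N, t ≤ hammingNorm (e + a) := by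
  obtain ⟨l, ⟨hlN, hlW⟩, hmin⟩ := Set.exists_min_image {x | x ∈ N ∧ x ∉ W} hammingNorm
    (Set.toFinite _) hne
  have hlt : t < hammingNorm l := by
    by_contra! hle
    refine hlW ?_
    simpa using hcor l 0 hle (by simp) (by simpa using hlN)
  obtain ⟨e, e', rfl, he, he'⟩ := exists_add_eq_hammingNorm l hlt.le
  refine ⟨e, he, fun a ha => ?_⟩
  by_contra! hc
  have haW : a ∈ W := by
    have h1 : e + (e + a) = a := by rw [← add_assoc, binVec_add_self, zero_add]
    rw [← h1] at ha ⊢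
    exact hcor e (e + a) he.le hc.le ha
  have h2 : hammingNorm (e + e') ≤ hammingNorm (e + e' + a) :=
    hmin (e + e' + a) ⟨N.add_mem hlN ha, fun h => hlW ((W.add_mem_iff_left haW).1 h)⟩
  have h3 : hammingNorm (e + e' + a) ≤ hammingNorm (e + a) + hammingNorm e' := by
    rw [add_right_comm]
    exact hammingNorm_add_le _ _
  omega

theorem CSSCode.Ancilla.exists_heavy_error {Q : CSSCode n} (S : Q.Ancilla) {t : ℕ}
    (hQ : Q.Corrects t) (τ : ErrorType) :
    ∃ e : BinVec (Fin n), hammingNorm e = t ∧ t ≤ errorWeight τ S.A e := by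
  have hrk : ∀ {r : ℕ} (H : Matrix (Fin r) (Fin n) (ZMod 2)),
      Module.finrank (ZMod 2) (Submodule.span (ZMod 2) (Set.range H.row)) ≤ r := fun H => by
    simpa [Set.finrank] using finrank_range_le_card (R := ZMod 2) H.row
  cases τ
  · obtain ⟨x, hx, hxW⟩ := exists_mem_ker_notMem Q.HZ Q.stabX
      ((Nat.add_le_add_left (hrk Q.HX) _).trans_lt Q.logical_pos)
    obtain ⟨e, he, hea⟩ := exists_heavy_of_correctable (t := t)
      (N := LinearMap.ker Q.HZ.mulVecLin) (W := Q.stabX) ⟨x, by simpa using hx, hxW⟩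
      (fun e e' he he' hN => (hQ (ErrorType.X.toPauli e) (ErrorType.X.toPauli e')
        (by rwa [pauliWeight_toPauli]) (by rwa [pauliWeight_toPauli])
        ⟨by simpa [ErrorType.toPauli] using hN, by simp [ErrorType.toPauli]⟩).1)
    exact ⟨e, he, le_errorWeight fun a ha => hea a (by simpa using S.le_codeZ a ha)⟩
  · obtain ⟨x, hx, hxW⟩ := exists_mem_ker_notMem Q.HX Q.stabZ
      ((Nat.add_le_add_left (hrk Q.HZ) _).trans_lt (by have := Q.logical_pos; omega))
    obtain ⟨e, he, hea⟩ := exists_heavy_of_correctable (t := t)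
      (N := LinearMap.ker Q.HX.mulVecLin) (W := Q.stabZ) ⟨x, by simpa using hx, hxW⟩
      (fun e e' he he' hN => (hQ (ErrorType.Z.toPauli e) (ErrorType.Z.toPauli e')
        (by rwa [pauliWeight_toPauli]) (by rwa [pauliWeight_toPauli])
        ⟨by simp [ErrorType.toPauli], by simpa [ErrorType.toPauli] using hN⟩).2)
    refine ⟨e, he, le_errorWeight fun a ha => hea a ?_⟩
    rw [LinearMap.mem_ker, mulVecLin_apply]
    funext i
    exact ha _ (S.stabX_le (Submodule.subset_span ⟨i, rfl⟩))

/-! ### Orders of magnitude of failure probabilities -/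

namespace Procedure

variable (P : Procedure n)

theorem prod_failures_eq_pow (p : ℝ) (ω : P.Pattern) [DecidableEq GateFailure] :
    (∏ g, if ω.1 g = 0 then 1 else p) * (∏ m, if ω.2 m = 0 then 1 else p) =
      p ^ P.numFailures ω := by
  classical
  simp only [Finset.prod_ite, Finset.prod_const, one_pow, one_mul, ← pow_add, numFailures,
    Set.ncard_eq_toFinset_card', Set.toFinset_ofPred, ne_eq]

theorem weight_nonneg {p : ℝ} (h0 : 0 ≤ p) (h1 : p ≤ 1) (ω : P.Pattern) : 0 ≤ P.weight p ω := by
  have h2 : 0 ≤ 1 - p := sub_nonneg.2 h1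
  refine mul_nonneg (Finset.prod_nonneg fun g _ => ?_) (Finset.prod_nonneg fun m _ => ?_) <;>
    split_ifs <;> positivity

theorem weight_le_pow {p : ℝ} (h0 : 0 ≤ p) (h1 : p ≤ 1) (ω : P.Pattern) :
    P.weight p ω ≤ p ^ P.numFailures ω := by
  have h2 : 0 ≤ 1 - p := sub_nonneg.2 h1
  rw [← prod_failures_eq_pow]
  refine mul_le_mul (Finset.prod_le_prod (fun g _ => ?_) fun g _ => ?_)
    (Finset.prod_le_prod (fun m _ => ?_) fun m _ => ?_)
    (Finset.prod_nonneg fun m _ => ?_) (Finset.prod_nonneg fun g _ => ?_) <;>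
    split_ifs <;> first | positivity | linarith

theorem le_weight {p : ℝ} (h0 : 0 ≤ p) (h1 : p ≤ 1 / 2) (ω : P.Pattern) :
    (1 / 15) ^ (Fintype.card P.Gate + Fintype.card P.Meas) * p ^ P.numFailures ω ≤
      2 ^ (Fintype.card P.Gate + Fintype.card P.Meas) * P.weight p ω := by
  have h2 : 0 ≤ 1 - p := by linarith
  have hconst : ∀ c : ℝ, c ^ (Fintype.card P.Gate + Fintype.card P.Meas) =
      (∏ _g : P.Gate, c) * ∏ _m : P.Meas, c := fun c => by
    simp [pow_add]
  rw [← prod_failures_eq_pow, weight, hconst, hconst, mul_mul_mul_comm,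
    ← Finset.prod_mul_distrib, ← Finset.prod_mul_distrib, mul_mul_mul_comm,
    ← Finset.prod_mul_distrib, ← Finset.prod_mul_distrib]
  refine mul_le_mul (Finset.prod_le_prod (fun g _ => ?_) fun g _ => ?_)
    (Finset.prod_le_prod (fun m _ => ?_) fun m _ => ?_)
    (Finset.prod_nonneg fun m _ => ?_) (Finset.prod_nonneg fun g _ => ?_) <;>
    split_ifs <;> first | positivity | linarith

theorem exists_prob_le {S : Set P.Pattern} {m : ℕ} (hS : ∀ ω ∈ S, m ≤ P.numFailures ω) :
    ∃ C : ℝ, ∀ p : ℝ, 0 ≤ p → p ≤ 1 → P.prob p S ≤ C * p ^ m := by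
  classical
  refine ⟨(Finset.univ : Finset P.Pattern).card, fun p h0 h1 => ?_⟩
  rw [prob, ← nsmul_eq_mul]
  convert Finset.sum_le_card_nsmul Finset.univ _ (p ^ m) fun ω _ => ?_
  split_ifs with h
  · exact (P.weight_le_pow h0 h1 ω).trans (pow_le_pow_of_le_one h0 h1 (hS ω h))
  · positivity

theorem weight_le_prob {p : ℝ} (h0 : 0 ≤ p) (h1 : p ≤ 1) {S : Set P.Pattern} {ω : P.Pattern}
    (hω : ω ∈ S) : P.weight p ω ≤ P.prob p S := by
  classical
  have h := Finset.single_le_sum (f := fun ω : P.Pattern => if ω ∈ S then P.weight p ω else 0)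
    (fun ω _ => by split_ifs; exacts [P.weight_nonneg h0 h1 ω, le_rfl])
    (Finset.mem_univ ω)
  simp only [hω, if_true] at h
  refine h.trans (le_of_eq ?_)
  unfold prob
  congr!

theorem prob_nonneg {p : ℝ} (h0 : 0 ≤ p) (h1 : p ≤ 1) (S : Set P.Pattern) : 0 ≤ P.prob p S := by
  refine Finset.sum_nonneg fun ω _ => ?_
  split_ifs
  exacts [P.weight_nonneg h0 h1 ω, le_rfl]

theorem exists_le_prob {S : Set P.Pattern} {ω : P.Pattern} (hω : ω ∈ S) :
    ∃ c : ℝ, 0 < c ∧ ∀ p : ℝ, 0 ≤ p → p ≤ 1 / 2 → c * p ^ P.numFailures ω ≤ P.prob p S := by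
  refine ⟨(1 / 15) ^ (Fintype.card P.Gate + Fintype.card P.Meas) /
    2 ^ (Fintype.card P.Gate + Fintype.card P.Meas), by positivity, fun p h0 h1 => ?_⟩
  refine le_trans ?_ (P.weight_le_prob h0 (by linarith) hω)
  rw [div_mul_eq_mul_div, div_le_iff₀' (by positivity)]
  exact P.le_weight h0 h1 ω

theorem eventually_mem_Ioc_half : ∀ᶠ p : ℝ in 𝓝[>] 0, 0 < p ∧ p ≤ 1 / 2 :=
  Ioc_mem_nhdsGT (by norm_num)

@[simp]
theorem numFailures_zero : P.numFailures 0 = 0 := by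
  simp [numFailures]

variable {P} {τ : ErrorType} {A : Submodule (ZMod 2) (BinVec (Fin n))} {t : ℕ}

/-- If fewer than `t` failures never leave an error whose weight exceeds their number, then the
output is qualified with certainty. -/
theorem qualifiedWithProb_one (h0 : P.Accepted 0)
    (h : ∀ ω, P.Accepted ω → P.numFailures ω < t →
      ∀ e, τ.part (P.error ω) + e ∈ trivialGroup A τ → errorWeight τ A e ≤ P.numFailures ω) :
    P.QualifiedWithProb τ A t 1 := by
  refine ⟨Set.univ, fun ℓ p _ _ => by simp, fun e => ?_⟩
  obtain ⟨C, hC⟩ := P.exists_prob_le (m := min (errorWeight τ A e) t)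
    (S := Set.univ ∩ P.acceptEvent ∩ P.residualEvent τ A e) (by
      rintro ω ⟨⟨-, hacc⟩, hres⟩
      by_cases hlt : P.numFailures ω < t
      · exact (min_le_left _ _).trans (h ω hacc hlt e hres)
      · exact (min_le_right _ _).trans (not_lt.1 hlt))
  obtain ⟨c, hc, hcp⟩ := P.exists_le_prob (S := P.acceptEvent) (ω := 0) h0
  refine IsBigO.of_bound (C / c) ?_
  filter_upwards [eventually_mem_Ioc_half] with p hp
  have h1 : c ≤ P.prob p P.acceptEvent := by simpa using hcp p hp.1.le hp.2
  have h2 := hC p hp.1.le (by linarith)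
  have h3 := P.prob_nonneg hp.1.le (by linarith) (Set.univ ∩ P.acceptEvent ∩ P.residualEvent τ A e)
  rw [Real.norm_of_nonneg (div_nonneg h3 (hc.le.trans h1)),
    Real.norm_of_nonneg (pow_nonneg hp.1.le _),
    div_mul_eq_mul_div]
  exact div_le_div₀ (h3.trans h2) h2 hc h1

/-- If the output is qualified with certainty, then an accepted pattern of fewer than `t` failures
leaves an error whose weight is at most the number of failures. -/
theorem QualifiedWithProb.min_errorWeight_le (h : P.QualifiedWithProb τ A t 1) {ω : P.Pattern}
    (hacc : P.Accepted ω) {e : BinVec (Fin n)}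
    (he : τ.part (P.error ω) + e ∈ trivialGroup A τ) :
    min (errorWeight τ A e) t ≤ P.numFailures ω := by
  obtain ⟨U, hU, hqual⟩ := h
  -- Given that the block is kept, an event of probability one contains every accepted pattern.
  have hωU : ω ∈ U := by
    by_contra hωU
    have hle := hU (P.numFailures ω) (1 / 2) (by norm_num) (by norm_num)
    rw [one_mul, ← not_lt] at hle
    refine hle ?_
    classical
    unfold prob
    refine Finset.sum_lt_sum (fun ω' _ => ?_) ⟨ω, Finset.mem_univ ω, ?_⟩
    · by_cases h1 : ω' ∈ U ∩ P.acceptEvent ∩ {ω' | P.numFailures ω' = P.numFailures ω}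
      · rw [if_pos h1, if_pos ⟨h1.1.2, h1.2⟩]
      · rw [if_neg h1]
        split_ifs
        exacts [P.weight_nonneg (by norm_num) (by norm_num) ω', le_rfl]
    · rw [if_neg fun h1 => hωU h1.1.1, if_pos ⟨hacc, rfl⟩]
      have h2 := P.le_weight (p := 1 / 2) (by norm_num) le_rfl ω
      by_contra! h3
      have h4 : P.weight (1 / 2) ω = 0 :=
        le_antisymm h3 (P.weight_nonneg (by norm_num) (by norm_num) ω)
      rw [h4, mul_zero, ← not_lt] at h2
      exact h2 (by positivity)
  by_contra! hlt
  obtain ⟨c, hc, hcp⟩ := P.exists_le_prob (ω := ω)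
    (S := U ∩ P.acceptEvent ∩ P.residualEvent τ A e) ⟨⟨hωU, hacc⟩, he⟩
  obtain ⟨C, hC⟩ := P.exists_prob_le (S := P.acceptEvent) (m := 0) fun _ _ => Nat.zero_le _
  obtain ⟨c', hc', hcp'⟩ := P.exists_le_prob (S := P.acceptEvent) (ω := ω) hacc
  have hO : (fun p : ℝ => p ^ P.numFailures ω) =O[𝓝[>] 0] fun p : ℝ =>
      P.prob p (U ∩ P.acceptEvent ∩ P.residualEvent τ A e) / P.prob p P.acceptEvent := by
    refine IsBigO.of_bound (C / c) ?_
    filter_upwards [eventually_mem_Ioc_half] with p hp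
    have h1 := hcp p hp.1.le hp.2
    have h2 : P.prob p P.acceptEvent ≤ C := by simpa using hC p hp.1.le (by linarith)
    have hpow : 0 < p ^ P.numFailures ω := pow_pos hp.1 _
    have h3 : 0 < P.prob p P.acceptEvent :=
      (mul_pos hc' hpow).trans_le (hcp' p hp.1.le hp.2)
    rw [Real.norm_of_nonneg hpow.le,
      Real.norm_of_nonneg (div_nonneg ((mul_pos hc hpow).le.trans h1) h3.le),
      div_mul_div_comm, le_div_iff₀ (mul_pos hc h3)]
    calc p ^ P.numFailures ω * (c * P.prob p P.acceptEvent)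
        = P.prob p P.acceptEvent * (c * p ^ P.numFailures ω) := by ring
      _ ≤ C * _ := mul_le_mul h2 h1 (mul_pos hc hpow).le (h3.le.trans h2)
  refine (hO.trans (hqual e)).not_isLittleO ?_ ((isLittleO_pow_pow hlt).mono nhdsWithin_le_nhds)
  refine Eventually.frequently ?_
  filter_upwards [eventually_mem_Ioc_half] with p hp
  exact (pow_pos hp.1 _).ne'

theorem exists_failure_of_ne_zero {ω : P.Pattern} (h : ω ≠ 0) :
    (∃ g, ω.1 g ≠ 0) ∨ ∃ m, ω.2 m ≠ 0 := by
  by_contra! hc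
  exact h (Prod.ext (funext hc.1) (funext hc.2))

/-- If each failure is blamed for at most one item, then there are no more items to be blamed for
than failures. -/
theorem card_le_numFailures {β : Type} (B : Finset β) (ω : P.Pattern)
    (r : β → P.Gate ⊕ P.Meas → Prop) (hr : ∀ b b' x, r b x → r b' x → b = b')
    (hB : ∀ b ∈ B, (∃ g, ω.1 g ≠ 0 ∧ r b (Sum.inl g)) ∨ ∃ m, ω.2 m ≠ 0 ∧ r b (Sum.inr m)) :
    B.card ≤ P.numFailures ω := by
  classical
  let G : Finset P.Gate := Finset.univ.filter fun g => ω.1 g ≠ 0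
  let M : Finset P.Meas := Finset.univ.filter fun m => ω.2 m ≠ 0
  have hcard : P.numFailures ω = (G.disjSum M).card := by
    rw [Finset.card_disjSum, numFailures, Set.ncard_eq_toFinset_card', Set.ncard_eq_toFinset_card']
    simp [G, M]
  have hex : ∀ b ∈ B, ∃ x ∈ G.disjSum M, r b x := by
    intro b hb
    obtain ⟨g, hg, hrg⟩ | ⟨m, hm, hrm⟩ := hB b hb
    · exact ⟨Sum.inl g, by simpa [G] using hg, hrg⟩
    · exact ⟨Sum.inr m, by simpa [M] using hm, hrm⟩
  rw [hcard]
  obtain rfl | ⟨b₀, hb₀⟩ := B.eq_empty_or_nonempty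
  · simp
  have : Nonempty (P.Gate ⊕ P.Meas) := ⟨(hex b₀ hb₀).choose⟩
  choose! f hf hrf using hex
  refine Finset.card_le_card_of_injOn f hf fun b hb b' hb' hbb => ?_
  exact hr b b' (f b) (hrf b hb) (hbb ▸ hrf b' hb')

end Procedure

/-! ### Encoding circuits -/

theorem basisAction_append {q : Type} [DecidableEq q] (l l' : List (q × q)) (x : BinVec q) :
    basisAction (l ++ l') x = basisAction l' (basisAction l x) :=
  List.foldl_append

theorem basisAction_append_reverse {q : Type} [DecidableEq q] (l : List (q × q))
    (hl : ∀ g ∈ l, g.1 ≠ g.2) (x : BinVec q) : basisAction (l ++ l.reverse) x = x := by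
  induction l generalizing x with
  | nil => rfl
  | cons g l ih =>
    have h : basisAction (g :: l ++ (g :: l).reverse) x =
        basisAction [g] (basisAction (l ++ l.reverse) (basisAction [g] x)) := by
      rw [← basisAction_append, ← basisAction_append]
      simp
    rw [h, ih fun g' hg' => hl g' (List.mem_cons_of_mem _ hg')]
    have hg : g.1 ≠ g.2 := hl g List.mem_cons_self
    simp [basisAction, hg, add_assoc, CharTwo.add_self_eq_zero]

theorem exists_basisAction_eq_transvections
    (L : List (TransvectionStruct (Fin n) (ZMod 2))) :
    ∃ gates : List (Fin n × Fin n), (∀ g ∈ gates, g.1 ≠ g.2) ∧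
      ∀ x, basisAction gates x = (L.map TransvectionStruct.toMatrix).prod *ᵥ x := by
  induction L with
  | nil => exact ⟨[], by simp, fun x => by simp [basisAction]⟩
  | cons s L ih =>
    obtain ⟨gates, hne, hgates⟩ := ih
    obtain ⟨i, j, hij, c⟩ := s
    by_cases hc : c = 0
    · refine ⟨gates, hne, fun x => ?_⟩
      simp [hgates, hc, transvection_zero]
    · refine ⟨gates ++ [(j, i)], ?_, fun x => ?_⟩
      · simp only [List.mem_append, List.mem_singleton]
        rintro g (hg | rfl)
        exacts [hne g hg, hij.symm]
      · rw [basisAction_append, hgates, List.map_cons, List.prod_cons, ← mulVec_mulVec]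
        generalize (L.map TransvectionStruct.toMatrix).prod *ᵥ x = y
        funext a
        rw [zmod_two_eq_one hc, TransvectionStruct.toMatrix_mk, transvection, add_mulVec,
          one_mulVec, single_mulVec]
        obtain rfl | ha := eq_or_ne a i <;> simp [basisAction, *]

/-- Every CSS stabilizer state has an encoding circuit: a matrix with range `A` is the product of
transvections, a diagonal matrix and transvections. The diagonal tells which qubits start in
`|+⟩`, and the transvections on the left are the CNOT gates. -/
theorem nonempty_encodingCircuit (A : Submodule (ZMod 2) (BinVec (Fin n))) :
    Nonempty (EncodingCircuit A) := by
  obtain ⟨f, hf⟩ := A.subtype.exists_leftInverse_of_injective (Submodule.ker_subtype A)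
  have hmem : ∀ y, y ∈ A ↔ ∃ x, LinearMap.toMatrix' (A.subtype ∘ₗ f) *ᵥ x = y := by
    intro y
    simp only [LinearMap.toMatrix'_mulVec, LinearMap.comp_apply]
    refine ⟨fun hy => ⟨y, ?_⟩, ?_⟩
    · exact congrArg A.subtype (LinearMap.congr_fun hf ⟨y, hy⟩)
    · rintro ⟨x, rfl⟩
      exact (f x).2
  obtain ⟨L, L', D, hM⟩ := Pivot.exists_list_transvec_mul_diagonal_mul_list_transvec
    (LinearMap.toMatrix' (A.subtype ∘ₗ f))
  obtain ⟨gates, hne, hgates⟩ := exists_basisAction_eq_transvections L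
  refine ⟨⟨Finset.univ.filter fun i => D i ≠ 0, gates, hne, ?_⟩⟩
  have hunit : IsUnit (L'.map TransvectionStruct.toMatrix).prod.det := by
    rw [TransvectionStruct.det_toMatrix_prod]
    exact isUnit_one
  ext y
  rw [SetLike.mem_coe, hmem, hM]
  constructor
  · rintro ⟨x, hx, rfl⟩
    refine ⟨(L'.map TransvectionStruct.toMatrix).prod⁻¹ *ᵥ fun i => (D i)⁻¹ * x i, ?_⟩
    rw [← mulVec_mulVec, ← mulVec_mulVec, mulVec_mulVec _ _ (_⁻¹), mul_nonsing_inv _ hunit,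
      one_mulVec, hgates]
    congr 1
    funext i
    rw [mulVec_diagonal]
    by_cases hi : D i = 0
    · simp [hi, hx i (by simp [hi])]
    · rw [mul_inv_cancel_left₀ hi]
  · rintro ⟨x, rfl⟩
    refine ⟨diagonal D *ᵥ (L'.map TransvectionStruct.toMatrix).prod *ᵥ x, fun i hi => ?_, ?_⟩
    · have hi' : D i = 0 := by simpa using hi
      rw [mulVec_diagonal, hi', zero_mul]
    · rw [hgates, ← mulVec_mulVec, ← mulVec_mulVec]

/-! ### Faults of an encoding circuit -/

section Propagation

variable {q : Type} [DecidableEq q]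

@[simp]
theorem applyFailure_zero (g : q × q) (E : Pauli q) : applyFailure g 0 E = E := by
  simp [applyFailure]

@[simp]
theorem conjCNOT_zero (g : q × q) : conjCNOT g 0 = 0 := by
  simp [conjCNOT]

theorem propagate_zero (l : List (q × q)) : propagate l 0 0 = 0 := by
  induction l with
  | nil => rfl
  | cons g l ih =>
    refine Eq.trans ?_ ih
    simp only [propagate, Pi.zero_apply, applyFailure_zero, conjCNOT_zero]
    rfl

theorem exists_propagate_single_failure {gates l l' : List (q × q)} {g : q × q}
    (h : gates = l ++ g :: l') (x : GateFailure) :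
    ∃ φ : Fin gates.length → GateFailure, {i | φ i ≠ 0}.ncard ≤ 1 ∧
      propagate gates φ 0 = propagate l' 0 (applyFailure g x 0) := by
  subst h
  induction l with
  | nil =>
    refine ⟨Fin.cons x 0, ?_, ?_⟩
    · refine (Set.ncard_le_one (Set.toFinite _)).2 fun a ha b hb => ?_
      revert ha hb
      refine Fin.cases ?_ (fun a => ?_) a <;> refine Fin.cases ?_ (fun b => ?_) b <;> simp
    · simp [propagate]
      rfl
  | cons g' l ih =>
    obtain ⟨φ, hφ, hp⟩ := ih
    refine ⟨Fin.cons 0 φ, ?_, ?_⟩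
    · refine (Set.ncard_le_ncard (t := Fin.succ '' {i | φ i ≠ 0}) ?_ (Set.toFinite _)).trans
        ((Set.ncard_image_le (Set.toFinite _)).trans hφ)
      intro i
      refine Fin.cases ?_ (fun i => ?_) i <;> simp
    · rw [← hp]
      simp [propagate]

end Propagation

/-- The CNOT gate that copies an error of type `τ` from qubit `i` to qubit `a`. -/
def copyGate : ErrorType → Fin n → Fin n → Fin n × Fin n
  | ErrorType.X, i, a => (i, a)
  | ErrorType.Z, i, a => (a, i)

theorem propagate_copyGates (τ : ErrorType) (i : Fin n) (l : List (Fin n)) (hl : i ∉ l)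
    (v : BinVec (Fin n)) (hv : v i = 1) :
    propagate (l.map (copyGate τ i)) 0 (τ.toPauli v) =
      τ.toPauli (v + (l.map fun a => Pi.single a 1).sum) := by
  induction l generalizing v with
  | nil =>
    simp only [List.map_nil, List.sum_nil, add_zero]
    rfl
  | cons a l ih =>
    have hia : i ≠ a := fun h => hl (by simp [h])
    have hstep : conjCNOT (copyGate τ i a) (τ.toPauli v) =
        τ.toPauli (v + Pi.single a 1) := by
      have hupd : Function.update v a (v a + 1) = v + Pi.single a 1 := by
        funext b
        obtain rfl | hb := eq_or_ne b a <;> simp [*]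
      cases τ <;> simp [conjCNOT, copyGate, ErrorType.toPauli, hv, hupd]
    have := ih (fun h => hl (List.mem_cons_of_mem _ h)) (v + Pi.single a 1) (by simp [hv, hia])
    rw [List.map_cons, List.map_cons, List.sum_cons, ← add_assoc, ← this]
    simp only [propagate, Pi.zero_apply, applyFailure_zero, hstep]
    rfl

/-- The failure of `copyGate τ i a` that leaves an error of type `τ` on qubit `i`. -/
def sourceFailure : ErrorType → GateFailure
  | ErrorType.X => ((1, 0), (0, 0))
  | ErrorType.Z => ((0, 0), (0, 1))

theorem applyFailure_sourceFailure (τ : ErrorType) (i a : Fin n) :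
    applyFailure (copyGate τ i a) (sourceFailure τ) 0 = τ.toPauli (Pi.single i 1) := by
  cases τ <;> simp [applyFailure, copyGate, sourceFailure, ErrorType.toPauli]

/-- A single failure of a suitable encoding circuit leaves any prescribed correlated error: the
circuit ends with a fan-out of CNOT gates, applied twice so as to have no net effect, and the
failure happens halfway. -/
theorem exists_encodingCircuit_fault (A : Submodule (ZMod 2) (BinVec (Fin n))) (τ : ErrorType)
    {e : BinVec (Fin n)} (he : 2 ≤ hammingNorm e) :
    ∃ (P : EncodingCircuit A) (ω : P.procedure.Pattern),
      P.procedure.numFailures ω ≤ 1 ∧ P.procedure.error ω = τ.toPauli e := by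
  obtain ⟨P⟩ := nonempty_encodingCircuit A
  let T : Finset (Fin n) := Finset.univ.filter fun i => e i ≠ 0
  have hT : 1 < T.card := he
  obtain ⟨i, hi, a₀, ha₀, hia₀⟩ := Finset.one_lt_card.1 hT
  have hl : i ∉ (T.erase i).toList := by simp
  have hmem : a₀ ∈ (T.erase i).toList := by simp [ha₀, hia₀.symm]
  have hsum : Pi.single i 1 + ((T.erase i).toList.map fun a => Pi.single a 1).sum = e := by
    rw [Finset.sum_map_toList, Finset.add_sum_erase T (fun a => (Pi.single a 1 : BinVec (Fin n))) hi]
    funext b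
    rw [Finset.sum_apply]
    simp only [Pi.single_apply, Finset.sum_ite_eq, T, Finset.mem_filter, Finset.mem_univ, true_and]
    split_ifs with hb
    · exact (zmod_two_eq_one hb).symm
    · exact (not_not.1 hb).symm
  generalize (T.erase i).toList = l at hl hmem hsum
  obtain - | ⟨a, l'⟩ := l
  · simp at hmem
  have hne : ∀ g ∈ (a :: l').map (copyGate τ i), g.1 ≠ g.2 := by
    intro g hg
    obtain ⟨b, hb, rfl⟩ := List.mem_map.1 hg
    have hib : i ≠ b := fun h => hl (h ▸ hb)
    cases τ
    exacts [hib, hib.symm]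
  have hid : ∀ x, basisAction (P.gates ++ (((a :: l').map (copyGate τ i)).reverse ++
      (a :: l').map (copyGate τ i))) x = basisAction P.gates x := by
    intro x
    rw [basisAction_append]
    have := basisAction_append_reverse ((a :: l').map (copyGate τ i)).reverse
      (fun g hg => hne g (List.mem_reverse.1 hg)) (basisAction P.gates x)
    rwa [List.reverse_reverse] at this
  let P' : EncodingCircuit A :=
    { plus := P.plus
      gates := P.gates ++ (((a :: l').map (copyGate τ i)).reverse ++
        (a :: l').map (copyGate τ i))
      control_ne_target := by
        intro g hg
        simp only [List.mem_append, List.mem_reverse] at hg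
        obtain hg | hg | hg := hg
        exacts [P.control_ne_target g hg, hne g hg, hne g hg]
      prepares := by
        rw [← P.prepares]
        exact Set.image_congr fun x _ => hid x }
  obtain ⟨φ, hφ, hp⟩ := exists_propagate_single_failure (gates := P'.gates)
    (l := P.gates ++ (l'.map (copyGate τ i)).reverse) (g := copyGate τ i a)
    (l' := (a :: l').map (copyGate τ i)) (by simp [P']) (sourceFailure τ)
  refine ⟨P', (φ, 0), ?_, ?_⟩
  · have hmeas : {m : P'.procedure.Meas | (0 : P'.procedure.Meas → ZMod 2) m ≠ 0} = ∅ := by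
      simp
    rw [Procedure.numFailures, hmeas, Set.ncard_empty]
    exact hφ
  · rw [applyFailure_sourceFailure, propagate_copyGates τ i _ hl _ (by simp), hsum] at hp
    exact hp

/-! ### Propagation of errors through a round of distillation -/

@[simp]
theorem ErrorType.part_zero {q : Type} (τ : ErrorType) : τ.part (0 : Pauli q) = 0 := by
  cases τ <;> rfl

theorem ErrorType.part_add {q : Type} (τ : ErrorType) (E E' : Pauli q) :
    τ.part (E + E') = τ.part E + τ.part E' := by
  cases τ <;> rfl

@[simp]
theorem ErrorType.part_toPauli {q : Type} (τ : ErrorType) (v : BinVec q) :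
    τ.part (τ.toPauli v) = v := by
  cases τ <;> rfl

@[simp]
theorem ErrorType.part_swap_toPauli {q : Type} (τ : ErrorType) (v : BinVec q) :
    τ.part (τ.swap.toPauli v) = 0 := by
  cases τ <;> rfl

@[simp]
theorem ErrorType.swap_part_toPauli {q : Type} (τ : ErrorType) (v : BinVec q) :
    τ.swap.part (τ.toPauli v) = 0 := by
  cases τ <;> rfl

namespace Round

variable {τ : ErrorType} {A : Submodule (ZMod 2) (BinVec (Fin n))} (R : Round τ A)

theorem part_gate_inr (g : Fin R.code.r × Fin R.code.k × Fin n) (x : GateFailure)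
    (E : Pauli R.Qubit) {a : Fin n} (h : x = 0 ∨ g.2.2 ≠ a) (j : Fin R.code.k) :
    τ.part (applyFailure (R.gateOf τ g) x (conjCNOT (R.gateOf τ g) E)) (Sum.inr j, a) =
      τ.part E (Sum.inr j, a) := by
  obtain rfl | h := h
  · rw [applyFailure_zero]
    cases τ <;> simp [ErrorType.part, conjCNOT, gateOf]
  · cases τ <;> simp [ErrorType.part, applyFailure, conjCNOT, gateOf, h.symm]

theorem part_gate_inl (g : Fin R.code.r × Fin R.code.k × Fin n) (x : GateFailure)
    (E : Pauli R.Qubit) {a : Fin n} (h : x = 0 ∨ g.2.2 ≠ a) (i : Fin R.code.r) :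
    τ.part (applyFailure (R.gateOf τ g) x (conjCNOT (R.gateOf τ g) E)) (Sum.inl i, a) =
      τ.part E (Sum.inl i, a) +
        if g.1 = i ∧ g.2.2 = a then τ.part E (Sum.inr g.2.1, a) else 0 := by
  obtain rfl | h := h
  · rw [applyFailure_zero]
    by_cases hg : g.1 = i ∧ g.2.2 = a
    · obtain ⟨rfl, rfl⟩ := hg
      cases τ <;> simp [ErrorType.part, conjCNOT, gateOf]
    · have hg' : ¬ (i = g.1 ∧ a = g.2.2) := fun h => hg ⟨h.1.symm, h.2.symm⟩
      cases τ <;> simp [ErrorType.part, conjCNOT, gateOf, hg, hg']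
  · cases τ <;> simp [ErrorType.part, applyFailure, conjCNOT, gateOf, h, h.symm]

/-- Qubits `a` of all blocks, as long as no gate on them fails: errors of type `τ` spread only from
output blocks to check blocks. -/
theorem part_propagate (l : List (Fin R.code.r × Fin R.code.k × Fin n))
    (φ : Fin (l.map (R.gateOf τ)).length → GateFailure) (E : Pauli R.Qubit) {a : Fin n}
    (hφ : ∀ k, φ k ≠ 0 → ((l.map (R.gateOf τ)).get k).1.2 ≠ a) :
    (∀ j, τ.part (propagate (l.map (R.gateOf τ)) φ E) (Sum.inr j, a) =
      τ.part E (Sum.inr j, a)) ∧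
    ∀ i, τ.part (propagate (l.map (R.gateOf τ)) φ E) (Sum.inl i, a) =
      τ.part E (Sum.inl i, a) + (l.map fun g =>
        if g.1 = i ∧ g.2.2 = a then τ.part E (Sum.inr g.2.1, a) else 0).sum := by
  induction l generalizing E with
  | nil => exact ⟨fun j => rfl, fun i => (add_zero _).symm⟩
  | cons g l ih =>
    change Fin ((l.map (R.gateOf τ)).length + 1) → GateFailure at φ
    have hg : φ 0 = 0 ∨ g.2.2 ≠ a := by
      by_cases h0 : φ 0 = 0
      · exact Or.inl h0
      · refine Or.inr fun h => hφ (0 : Fin ((l.map (R.gateOf τ)).length + 1)) h0 ?_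
        rw [← h]
        cases τ <;> rfl
    obtain ⟨h1, h2⟩ := ih (fun k => φ k.succ)
      (applyFailure (R.gateOf τ g) (φ 0) (conjCNOT (R.gateOf τ g) E)) fun k hk => hφ k.succ hk
    simp only [R.part_gate_inr g _ E hg, R.part_gate_inl g _ E hg] at h1 h2
    refine ⟨h1, fun i => (h2 i).trans ?_⟩
    rw [List.map_cons, List.sum_cons, add_assoc]

theorem sum_schedule (x : Fin R.code.k → ZMod 2) (i : Fin R.code.r) (a : Fin n) :
    (R.schedule.map fun g => if g.1 = i ∧ g.2.2 = a then x g.2.1 else 0).sum =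
      (R.code.M *ᵥ x) i := by
  classical
  rw [← List.sum_toFinset _ R.schedule_nodup, ← Finset.univ_inter R.schedule.toFinset,
    ← Finset.sum_ite_mem]
  simp only [Fintype.sum_prod_type, List.mem_toFinset, R.mem_schedule, mulVec, dotProduct]
  rw [Finset.sum_eq_single i (fun i' _ hi' => by simp [hi']) (by simp)]
  refine Finset.sum_congr rfl fun j _ => ?_
  rw [Finset.sum_eq_single a (fun a' _ ha' => by simp [ha']) (by simp)]
  by_cases hM : R.code.M i j = 0
  · simp [hM]
  · simp [zmod_two_eq_one hM]

variable {R} {inp : R.code.Pos → Procedure n}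

/-- Qubit `a` of the blocks is affected by no failure of a gate of the distillation circuit. -/
def GateClean (ω : R.Pattern inp) (a : Fin n) : Prop :=
  ∀ k, ω.1 (Sum.inr k) ≠ 0 → (R.gates.get k).1.2 ≠ a

/-- The error of type `τ` on input block `b`. -/
def blockError (ω : R.Pattern inp) (b : R.code.Pos) : BinVec (Fin n) :=
  τ.part ((inp b).error (R.inputPattern ω b))

theorem part_inputError (ω : R.Pattern inp) (b : R.code.Pos) (a : Fin n) :
    τ.part (R.inputError ω) (b, a) = blockError ω b a := by
  cases τ <;> rfl

theorem part_circuitError_inr {ω : R.Pattern inp} {a : Fin n} (ha : GateClean ω a)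
    (j : Fin R.code.k) :
    τ.part (R.circuitError ω) (Sum.inr j, a) = blockError ω (Sum.inr j) a := by
  rw [← part_inputError]
  exact (R.part_propagate R.schedule _ (R.inputError ω) ha).1 j

theorem part_circuitError_inl {ω : R.Pattern inp} {a : Fin n} (ha : GateClean ω a)
    (i : Fin R.code.r) :
    τ.part (R.circuitError ω) (Sum.inl i, a) =
      (R.code.H *ᵥ fun b => blockError ω b a) i := by
  refine ((R.part_propagate R.schedule _ (R.inputError ω) ha).2 i).trans ?_
  simp only [part_inputError]
  rw [R.sum_schedule (fun j => blockError ω (Sum.inr j) a), ClassicalCode.H, fromCols_mulVec,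
    one_mulVec]
  rfl

theorem part_output_error (ω : R.Pattern inp) (j : Fin R.code.k) :
    τ.part ((R.output inp j).error ω) =
      (fun a => τ.part (R.circuitError ω) (Sum.inr j, a)) + R.recovery (R.estimate ω j) := by
  refine (ErrorType.part_add _ _ _).trans ?_
  rw [ErrorType.part_toPauli]
  cases τ <;> rfl

/-- The measured parity of a stabilizer `s` whose qubits are free of failures of the distillation
circuit and of the measurements is the classical syndrome of the bits of `s` on the inputs. -/
theorem dotProduct_measuredFlips {ω : R.Pattern inp} {s : BinVec (Fin n)}
    (hs : ∀ a, s a ≠ 0 → GateClean ω a ∧ ∀ i, ω.2 (Sum.inr (i, a)) = 0) (i : Fin R.code.r) :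
    s ⬝ᵥ R.measuredFlips ω i = (R.code.H *ᵥ fun b => s ⬝ᵥ blockError ω b) i := by
  have h : ∀ a, s a * R.measuredFlips ω i a =
      ∑ b, R.code.H i b * (s a * blockError ω b a) := by
    intro a
    by_cases hsa : s a = 0
    · simp [hsa]
    · rw [measuredFlips, part_circuitError_inl (hs a hsa).1, (hs a hsa).2 i, add_zero, mulVec,
        dotProduct, Finset.mul_sum]
      exact Finset.sum_congr rfl fun b _ => by ring
  simp only [mulVec, dotProduct, h, Finset.mul_sum]
  exact Finset.sum_comm

theorem decoder_zero : R.decoder 0 = 0 := by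
  simpa using R.decoder_corrects 0 (by simp)

/-! ### Few failures: the residual error is supported on few qubits -/

/-- As long as no more input blocks are damaged than the classical code can correct, the residual
error on a kept block is equivalent to one that acts only on qubits touched by failures of the
distillation circuit and of the measurements.

The stabilizers that vanish on these qubits are decoded correctly. Because the estimated syndrome
is valid, it is the syndrome of some error, which is thereby determined up to errors on these
qubits. -/
theorem exists_residual_supported {ω : R.Pattern inp} {j : Fin R.code.k} (hval : R.Valid ω j)
    (hdam : (Finset.univ.filter fun b => blockError ω b ≠ 0).card ≤ R.code.numCorrectable)
    (F : Finset (Fin n))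
    (hF : ∀ a, a ∉ F → GateClean ω a ∧ ∀ i, ω.2 (Sum.inr (i, a)) = 0) :
    ∃ g : BinVec (Fin n), (∀ a, a ∉ F → g a = 0) ∧
      τ.part ((R.output inp j).error ω) + g ∈ trivialGroup A τ := by
  obtain ⟨c, hc⟩ := exists_error_of_additive hval
  have hc' : R.estimate ω j = completeSyndrome τ A c := funext hc
  have hrec : ∀ s : checkGroup A τ, (s : BinVec (Fin n)) ⬝ᵥ R.recovery (R.estimate ω j) =
      R.estimate ω j s := by
    intro s
    have := congrFun (R.recovery_spec c) s
    rw [← hc'] at this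
    exact this
  simp only [mem_trivialGroup_iff]
  refine exists_supported_of_orthogonal _ F _ fun s hs hsF => ?_
  have hclean : ∀ a, s a ≠ 0 → GateClean ω a ∧ ∀ i, ω.2 (Sum.inr (i, a)) = 0 :=
    fun a ha => hF a fun haF => ha (hsF a haF)
  have hest : R.estimate ω j ⟨s, hs⟩ = s ⬝ᵥ blockError ω (Sum.inr j) := by
    have h1 : (fun i => s ⬝ᵥ R.measuredFlips ω i) =
        R.code.H *ᵥ fun b => s ⬝ᵥ blockError ω b := funext (dotProduct_measuredFlips hclean)
    have h2 : hammingNorm (fun b => s ⬝ᵥ blockError ω b) ≤ R.code.numCorrectable := by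
      refine le_trans (Finset.card_le_card fun b hb => ?_) hdam
      simp only [Finset.mem_filter, Finset.mem_univ, true_and] at hb ⊢
      intro h0
      exact hb (by rw [h0, dotProduct_zero])
    rw [estimate, h1, R.decoder_corrects _ h2]
  have hcirc : (s ⬝ᵥ fun a => τ.part (R.circuitError ω) (Sum.inr j, a)) =
      s ⬝ᵥ blockError ω (Sum.inr j) := by
    refine Finset.sum_congr rfl fun a _ => ?_
    by_cases hsa : s a = 0
    · simp [hsa]
    · exact congrArg (s a * ·) (part_circuitError_inr (hclean a hsa).1 j)
  rw [part_output_error, dotProduct_add, hcirc, hrec ⟨s, hs⟩, hest, CharTwo.add_self_eq_zero]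

theorem valid_zero (h0 : ∀ b, τ.part ((inp b).error 0) = 0) (j : Fin R.code.k) :
    R.Valid (0 : R.Pattern inp) j := by
  have hflips : ∀ s : BinVec (Fin n), (fun i => s ⬝ᵥ R.measuredFlips (0 : R.Pattern inp) i) = 0 := by
    intro s
    funext i
    have hb : ∀ b, blockError (0 : R.Pattern inp) b = 0 := h0
    rw [dotProduct_measuredFlips fun a _ => ⟨fun k hk => absurd rfl hk, fun i => rfl⟩]
    simp only [hb, dotProduct_zero]
    exact congrFun (mulVec_zero _) i
  intro s s'
  simp only [estimate, hflips, decoder_zero, Pi.zero_apply, add_zero]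

/-- A classical code with `t ≤ t_c + 1` suffices. -/
theorem qualifiedWithProb_of_le {t : ℕ} (hacc : ∀ b, (inp b).Accepted 0)
    (h0 : ∀ b, τ.part ((inp b).error 0) = 0) (ht : t ≤ R.code.numCorrectable + 1)
    (j : Fin R.code.k) : (R.output inp j).QualifiedWithProb τ A t 1 := by
  classical
  refine Procedure.qualifiedWithProb_one ⟨hacc, valid_zero h0 j⟩ fun ω hω hlt e he => ?_
  have hdam : (Finset.univ.filter fun b => blockError (R := R) ω b ≠ 0).card ≤
      (R.output inp j).numFailures ω := by
    refine Procedure.card_le_numFailures (P := R.output inp j) _ ω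
      (fun b x => Sum.elim (fun g : R.GateLoc inp => ∃ g', g = Sum.inl ⟨b, g'⟩)
        (fun m : R.MeasLoc inp => ∃ m', m = Sum.inl ⟨b, m'⟩) x) ?_ ?_
    · rintro b b' (x | x) ⟨y, hy⟩ ⟨y', hy'⟩
      · have := hy.symm.trans hy'
        simp only [Sum.inl.injEq, Sigma.mk.injEq] at this
        exact this.1
      · have := hy.symm.trans hy'
        simp only [Sum.inl.injEq, Sigma.mk.injEq] at this
        exact this.1
    · intro b hb
      have hb' : R.inputPattern ω b ≠ 0 := by
        intro h
        refine (Finset.mem_filter.1 hb).2 ?_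
        exact (congrArg (fun ω' => τ.part ((inp b).error ω')) h).trans (h0 b)
      obtain ⟨g, hg⟩ | ⟨m, hm⟩ := Procedure.exists_failure_of_ne_zero hb'
      · exact Or.inl ⟨Sum.inl ⟨b, g⟩, hg, g, rfl⟩
      · exact Or.inr ⟨Sum.inl ⟨b, m⟩, hm, m, rfl⟩
  obtain ⟨g, hgF, hg⟩ := exists_residual_supported (R := R) (ω := ω) hω.2 (by omega)
    (Finset.univ.filter fun a => ¬ (GateClean (R := R) ω a ∧ ∀ i, ω.2 (Sum.inr (i, a)) = 0))
    (fun a ha => by simpa using ha)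
  have hge : e + g ∈ trivialGroup A τ := by
    have h1 : e + g = (τ.part ((R.output inp j).error ω) + e) +
        (τ.part ((R.output inp j).error ω) + g) := by
      rw [add_add_add_comm, binVec_add_self, zero_add]
    rw [h1]
    exact Submodule.add_mem _ he hg
  refine (errorWeight_le hge).trans ?_
  refine Procedure.card_le_numFailures (P := R.output inp j) _ ω
    (fun a x => Sum.elim (fun g : R.GateLoc inp => ∃ k, g = Sum.inr k ∧ (R.gates.get k).1.2 = a)
      (fun m : R.MeasLoc inp => ∃ i, m = Sum.inr (i, a)) x) ?_ ?_
  · rintro a a' (x | x) ⟨y, hy⟩ ⟨y', hy'⟩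
    · have := hy.1.symm.trans hy'.1
      rw [← hy.2, ← hy'.2, Sum.inr.inj this]
    · have := hy.symm.trans hy'
      simp only [Sum.inr.injEq, Prod.mk.injEq] at this
      exact this.2
  · intro a ha
    have ha' : ¬ (GateClean (R := R) ω a ∧ ∀ i, ω.2 (Sum.inr (i, a)) = 0) := by
      intro h
      exact (Finset.mem_filter.1 ha).2 (hgF a (by simpa using h))
    by_cases hc : GateClean (R := R) ω a
    · have : ∃ i, ω.2 (Sum.inr (i, a)) ≠ 0 := by
        by_contra! h
        exact ha' ⟨hc, h⟩
      obtain ⟨i, hi⟩ := this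
      exact Or.inr ⟨_, hi, i, rfl⟩
    · simp only [GateClean, not_forall, not_not] at hc
      obtain ⟨k, hk, hka⟩ := hc
      exact Or.inl ⟨_, hk, k, rfl, hka⟩

end Round

/-! ### Correlated errors that a weak classical code misses -/

namespace ClassicalCode

variable (C : ClassicalCode)

theorem exists_minDist_eq : ∃ v : BinVec C.Pos, v ≠ 0 ∧ C.H *ᵥ v = 0 ∧
    C.minDist = hammingNorm v := by
  let j : Fin C.k := ⟨0, C.k_pos⟩
  refine Nat.sInf_mem (s := {w | ∃ v : BinVec C.Pos, v ≠ 0 ∧ C.H *ᵥ v = 0 ∧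
    w = hammingNorm v}) ⟨_, Sum.elim (fun i => C.M i j) (Pi.single j 1), ?_, ?_, rfl⟩
  · intro h
    simpa using congrFun h (Sum.inr j)
  · rw [H, fromCols_mulVec, one_mulVec]
    funext i
    simp [CharTwo.add_self_eq_zero]

/-- Every syndrome decoder of a classical code fails on an output position for some pattern of
`t_c + 1` errors: a codeword of least weight splits into two such patterns, which have the same
syndrome and differ at an output position. -/
theorem exists_decoder_ne (D : BinVec (Fin C.r) → BinVec C.Pos) :
    ∃ (v : BinVec C.Pos) (j : Fin C.k), hammingNorm v ≤ C.numCorrectable + 1 ∧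
      D (C.H *ᵥ v) (Sum.inr j) ≠ v (Sum.inr j) := by
  obtain ⟨c, hc0, hHc, hd⟩ := C.exists_minDist_eq
  obtain ⟨j, hj⟩ : ∃ j, c (Sum.inr j) ≠ 0 := by
    by_contra! h
    refine hc0 (funext fun b => ?_)
    obtain i | j := b
    · have h1 := congrFun hHc i
      have h2 : c ∘ Sum.inr = 0 := funext h
      rw [H, fromCols_mulVec, one_mulVec, h2, mulVec_zero, add_zero] at h1
      exact h1
    · exact h j
  have hle : C.minDist / 2 ≤ hammingNorm c := by omega
  obtain ⟨v, v', rfl, hv, hv'⟩ := exists_add_eq_hammingNorm c hle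
  have hH : C.H *ᵥ v = C.H *ᵥ v' := by
    rw [mulVec_add] at hHc
    exact funext fun i => CharTwo.add_eq_zero.1 (congrFun hHc i)
  by_cases h : D (C.H *ᵥ v) (Sum.inr j) = v (Sum.inr j)
  · refine ⟨v', j, by unfold numCorrectable; omega, fun h' => hj ?_⟩
    rw [Pi.add_apply, ← h, ← h', hH, CharTwo.add_self_eq_zero]
  · exact ⟨v, j, by unfold numCorrectable; omega, h⟩

end ClassicalCode

namespace Round

variable {τ : ErrorType} {A : Submodule (ZMod 2) (BinVec (Fin n))} {R : Round τ A}
  {inp : R.code.Pos → Procedure n}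

/-- The failure pattern of a round in which failures happen only in the preparation of the input
blocks. -/
def inputFailures (ωs : ∀ b, (inp b).Pattern) : R.Pattern inp :=
  (Sum.elim (fun x => (ωs x.1).1 x.2) 0, Sum.elim (fun x => (ωs x.1).2 x.2) 0)

theorem numFailures_inputFailures (ωs : ∀ b, (inp b).Pattern) (j : Fin R.code.k) :
    (R.output inp j).numFailures (inputFailures ωs) = ∑ b, (inp b).numFailures (ωs b) := by
  classical
  have hsum : ∀ (P : Procedure n) (ω : P.Pattern), P.numFailures ω =
      (∑ g, if ω.1 g = 0 then 0 else 1) + ∑ m, if ω.2 m = 0 then 0 else 1 := by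
    intro P ω
    simp only [Procedure.numFailures, Set.ncard_eq_toFinset_card', Finset.card_eq_sum_ones,
      Finset.sum_ite, Finset.sum_const_zero, zero_add, Set.toFinset_ofPred, ne_eq]
  refine (hsum (R.output inp j) (inputFailures ωs)).trans ?_
  simp only [hsum, Finset.sum_add_distrib]
  congr 1
  · refine (Fintype.sum_sum_type _).trans ?_
    rw [Fintype.sum_sigma]
    simp only [inputFailures, Sum.elim_inl, Sum.elim_inr, Pi.zero_apply, if_true,
      Finset.sum_const_zero, add_zero]
    congr!
  · refine (Fintype.sum_sum_type _).trans ?_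
    rw [Fintype.sum_sigma]
    simp only [inputFailures, Sum.elim_inl, Sum.elim_inr, Pi.zero_apply, if_true,
      Finset.sum_const_zero, add_zero]
    congr!

/-- If one failure in the preparation of an input block can leave a correlated error of weight at
least `t`, then a classical code with `t ≤ t_c + 1` is necessary.

The same correlated error `e` is put on the at most `t_c + 1` blocks of a pattern that the decoder
misjudges on output block `j`. All stabilizers that detect `e` see this pattern and all others see
no error, so that the estimated syndrome is valid, and the error left on block `j` is `e`. -/
theorem le_of_qualifiedWithProb {t : ℕ} {e : BinVec (Fin n)} (hacc : ∀ b, (inp b).Accepted 0)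
    (h0 : ∀ b, τ.part ((inp b).error 0) = 0)
    (hfault : ∀ b, ∃ ω, (inp b).numFailures ω ≤ 1 ∧ (inp b).Accepted ω ∧
      τ.part ((inp b).error ω) = e)
    (he : t ≤ errorWeight τ A e)
    (hq : ∀ j, (R.output inp j).QualifiedWithProb τ A t 1) : t ≤ R.code.numCorrectable + 1 := by
  classical
  obtain ⟨v, j, hv, hj⟩ := R.code.exists_decoder_ne R.decoder
  choose ω₁ hω₁ hacc₁ herr₁ using hfault
  let ωs : ∀ b, (inp b).Pattern := fun b => if v b = 0 then 0 else ω₁ b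
  let ω : R.Pattern inp := inputFailures ωs
  have hblock : ∀ b, blockError ω b = v b • e := by
    intro b
    change τ.part ((inp b).error (ωs b)) = v b • e
    by_cases hb : v b = 0
    · simp only [ωs, if_pos hb, h0, hb, zero_smul]
    · simp only [ωs, if_neg hb, herr₁, zmod_two_eq_one hb, one_smul]
  have hclean : ∀ a, GateClean ω a := fun a k hk => absurd rfl hk
  have hflips : ∀ s : BinVec (Fin n), (fun i => s ⬝ᵥ R.measuredFlips ω i) =
      (s ⬝ᵥ e) • (R.code.H *ᵥ v) := by
    intro s
    funext i
    rw [dotProduct_measuredFlips (fun a _ => ⟨hclean a, fun i => rfl⟩), ← mulVec_smul]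
    simp only [hblock, dotProduct_smul, smul_eq_mul]
    congr 2
    funext b
    exact mul_comm _ _
  have hest : R.estimate ω j =
      completeSyndrome τ A (R.decoder (R.code.H *ᵥ v) (Sum.inr j) • e) := by
    funext s
    rw [estimate, hflips, completeSyndrome, dotProduct_smul]
    by_cases hs : (s : BinVec (Fin n)) ⬝ᵥ e = 0
    · simp [hs, decoder_zero]
    · simp [zmod_two_eq_one hs]
  have hvalid : R.Valid ω j := by
    intro s s'
    rw [hest]
    exact add_dotProduct _ _ _
  have hnum : (R.output inp j).numFailures ω ≤ R.code.numCorrectable + 1 := by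
    rw [numFailures_inputFailures]
    refine le_trans ?_ hv
    rw [hammingNorm, Finset.card_eq_sum_ones, Finset.sum_filter]
    refine Finset.sum_le_sum fun b _ => ?_
    by_cases hb : v b = 0
    · simp [ωs, hb]
    · simpa [ωs, hb] using hω₁ b
  have hres : τ.part ((R.output inp j).error ω) + e ∈ trivialGroup A τ := by
    have hrec := add_mem_trivialGroup_of_syndrome_eq
      (R.recovery_spec (R.decoder (R.code.H *ᵥ v) (Sum.inr j) • e))
    rw [← hest] at hrec
    convert hrec using 1
    rw [part_output_error]
    have hcirc : (fun a => τ.part (R.circuitError ω) (Sum.inr j, a)) = v (Sum.inr j) • e := by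
      rw [← hblock]
      exact funext fun a => part_circuitError_inr (hclean a) j
    -- The estimate for block `j` is wrong: exactly one of the two bits is `1`.
    have hone : R.decoder (R.code.H *ᵥ v) (Sum.inr j) = v (Sum.inr j) + 1 := by
      have hbit : ∀ x y : ZMod 2, x ≠ y → x = y + 1 := by decide
      exact hbit _ _ hj
    rw [hcirc, hone, add_smul, one_smul]
    abel
  have hmin := (hq j).min_errorWeight_le (ω := ω) ⟨fun b => ?_, hvalid⟩ hres
  · rw [min_eq_right he] at hmin
    exact hmin.trans hnum
  · change (inp b).Accepted (ωs b)
    by_cases hb : v b = 0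
    · simpa only [ωs, if_pos hb] using hacc b
    · simpa only [ωs, if_neg hb] using hacc₁ b

end Round

/-! ### Rounds for the opposite error type -/

theorem propagate_eq_self {q : Type} [DecidableEq q] (l : List (q × q)) {E : Pauli q}
    (hE : ∀ g ∈ l, E.1 g.1 = 0 ∧ E.2 g.2 = 0) : propagate l 0 E = E := by
  induction l with
  | nil => rfl
  | cons g l ih =>
    obtain ⟨h1, h2⟩ := hE g List.mem_cons_self
    have hstep : conjCNOT g E = E := by
      simp [conjCNOT, h1, h2]
    refine Eq.trans ?_ (ih fun g' hg' => hE g' (List.mem_cons_of_mem _ hg'))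
    simp only [propagate, Pi.zero_apply, applyFailure_zero, hstep]
    rfl

/-- An error of type `τ` on an output block passes unseen through a round that removes errors of
the opposite type: such errors spread only from check blocks to output blocks. -/
theorem Round.output_of_opposite {τ : ErrorType} {A : Submodule (ZMod 2) (BinVec (Fin n))}
    {R : Round τ.swap A} {inp : R.code.Pos → Procedure n} {ω : R.Pattern inp}
    (hgate : ∀ k, ω.1 (Sum.inr k) = 0) (hmeas : ∀ x, ω.2 (Sum.inr x) = 0)
    (hcheck : ∀ i, (inp (Sum.inl i)).error (R.inputPattern ω (Sum.inl i)) = 0)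
    (hout : ∀ j, τ.swap.part ((inp (Sum.inr j)).error (R.inputPattern ω (Sum.inr j))) = 0)
    (j : Fin R.code.k) :
    R.Valid ω j ∧ τ.part ((R.output inp j).error ω) =
      τ.part ((inp (Sum.inr j)).error (R.inputPattern ω (Sum.inr j))) := by
  have hblock : ∀ b, Round.blockError ω b = 0 := by
    rintro (i | j)
    · simp [Round.blockError, hcheck]
    · exact hout j
  have hflips : ∀ s : BinVec (Fin n), (fun i => s ⬝ᵥ R.measuredFlips ω i) = 0 := by
    intro s
    funext i
    rw [Round.dotProduct_measuredFlips
      (fun a _ => ⟨fun k hk => absurd (hgate k) hk, fun i => hmeas _⟩)]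
    simp only [hblock, dotProduct_zero]
    exact congrFun (mulVec_zero _) i
  refine ⟨fun s s' => by simp only [Round.estimate, hflips, Round.decoder_zero, Pi.zero_apply,
    add_zero], ?_⟩
  have hcirc : R.circuitError ω = R.inputError ω := by
    have h0 : (fun i => ω.1 (Sum.inr i)) = 0 := funext hgate
    rw [Round.circuitError, h0]
    refine propagate_eq_self _ fun g hg => ?_
    obtain ⟨⟨i, j, a⟩, -, rfl⟩ := List.mem_map.1 hg
    have hi := hcheck i
    have hj := congrFun (hout j) a
    cases τ
    · exact ⟨congrFun (congrArg Prod.fst hi) a, hj⟩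
    · exact ⟨hj, congrFun (congrArg Prod.snd hi) a⟩
  refine (ErrorType.part_add _ _ _).trans ?_
  rw [ErrorType.part_swap_toPauli, add_zero, hcirc]
  cases τ <;> rfl

end AncillaDistillation

open AncillaDistillation

theorem theorem4 :
    ∃ K : ℝ, 0 ≤ K ∧
      ∀ (n : ℕ) (Q : CSSCode n) (S : Q.Ancilla) (t : ℕ) (_ : Q.Corrects t)
        (τ : ErrorType) (ε : ℝ) (_ : IsSparse τ S.A ε),
        -- a round that acts on freshly encoded blocks
        (∀ R : Round τ S.A,
          t ≤ R.code.numCorrectable + 1 ↔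
            ∀ (P : EncodingCircuit S.A) (j : Fin R.code.k),
              (R.output (fun _ => P.procedure) j).QualifiedWithProb τ S.A t (1 - K * ε)) ∧
        -- a round that acts on output blocks of independent rounds for the opposite error type
        (∀ (R₁ : Round τ.swap S.A) (R : Round τ S.A) (pos : R.code.Pos → Fin R₁.code.k),
          t ≤ R.code.numCorrectable + 1 ↔
            ∀ (P : EncodingCircuit S.A) (j : Fin R.code.k),
              (R.output (fun b => R₁.output (fun _ => P.procedure) (pos b)) j).QualifiedWithProb
                τ S.A t (1 - K * ε)) := by
  -- A positive `K` is impossible: sparsity is monotone in `ε`, and once `1 ≤ K * ε` every block is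
  -- qualified within the empty event, whatever the classical code.
  refine ⟨0, le_rfl, fun n Q S t hQ τ ε _ => ?_⟩
  rw [zero_mul, sub_zero]
  have hfresh : ∀ P : EncodingCircuit S.A, P.procedure.error 0 = 0 := fun P => propagate_zero _
  obtain ⟨e, hnorm, he⟩ := S.exists_heavy_error hQ τ
  refine ⟨fun R => ⟨fun ht P j => ?_, fun hq => ?_⟩,
    fun R₁ R pos => ⟨fun ht P j => ?_, fun hq => ?_⟩⟩
  · exact Round.qualifiedWithProb_of_le (fun _ => trivial)
      (fun _ => by rw [hfresh, ErrorType.part_zero]) ht j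
  · by_cases ht : t < 2
    · omega
    -- For `t ≥ 2` the heavy error acts on two qubits or more, as the fan-out construction needs.
    obtain ⟨P, ω, hω, herr⟩ := exists_encodingCircuit_fault S.A τ (e := e) (by omega)
    exact Round.le_of_qualifiedWithProb (fun _ => trivial)
      (fun _ => by rw [hfresh, ErrorType.part_zero])
      (fun _ => ⟨ω, hω, trivial, by rw [herr, ErrorType.part_toPauli]⟩) he (hq P)
  · have hzero := fun j => Round.output_of_opposite (R := R₁) (inp := fun _ => P.procedure) (ω := 0)
      (fun _ => rfl) (fun _ => rfl) (fun _ => hfresh P)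
      (fun _ => (congrArg _ (hfresh P)).trans (ErrorType.part_zero _)) j
    exact Round.qualifiedWithProb_of_le
      (inp := fun b => R₁.output (fun _ => P.procedure) (pos b))
      (fun b => ⟨fun _ => trivial, (hzero _).1⟩)
      (fun b => (hzero _).2.trans ((congrArg _ (hfresh P)).trans (ErrorType.part_zero _))) ht j
  · by_cases ht : t < 2
    · omega
    obtain ⟨P, ω, hω, herr⟩ := exists_encodingCircuit_fault S.A τ (e := e) (by omega)
    have hzero := fun j => Round.output_of_opposite (R := R₁) (inp := fun _ => P.procedure) (ω := 0)
      (fun _ => rfl) (fun _ => rfl) (fun _ => hfresh P)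
      (fun _ => (congrArg _ (hfresh P)).trans (ErrorType.part_zero _)) j
    refine Round.le_of_qualifiedWithProb
      (inp := fun b => R₁.output (fun _ => P.procedure) (pos b))
      (fun b => ⟨fun _ => trivial, (hzero _).1⟩)
      (fun b => (hzero _).2.trans ((congrArg _ (hfresh P)).trans (ErrorType.part_zero _)))
      (fun b => ?_) he (hq P)
    let ωs : R₁.code.Pos → P.procedure.Pattern := Pi.single (Sum.inr (pos b)) ω
    have hsame : ωs (Sum.inr (pos b)) = ω := Pi.single_eq_same _ _
    have hother : ∀ b', b' ≠ Sum.inr (pos b) → ωs b' = 0 := fun b' hb' =>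
      Pi.single_eq_of_ne hb' _
    obtain ⟨hval, hpart⟩ := Round.output_of_opposite (R := R₁) (inp := fun _ => P.procedure)
      (ω := Round.inputFailures ωs) (fun _ => rfl) (fun _ => rfl)
      (fun i => by
        change P.procedure.error (ωs (Sum.inl i)) = 0
        rw [hother _ (by simp), hfresh])
      (fun j => by
        change τ.swap.part (P.procedure.error (ωs (Sum.inr j))) = 0
        by_cases hj : j = pos b
        · rw [hj, hsame, herr, ErrorType.swap_part_toPauli]
        · rw [hother _ (by simpa using hj), hfresh, ErrorType.part_zero])
      (pos b)
    refine ⟨Round.inputFailures ωs, ?_, ⟨fun _ => trivial, hval⟩, hpart.trans ?_⟩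
    · rw [Round.numFailures_inputFailures]
      refine (Finset.sum_eq_single (Sum.inr (pos b)) (fun b' _ hb' => ?_) (by simp)).trans_le ?_
      · rw [hother b' hb', Procedure.numFailures_zero]
      · rwa [hsame]
    · change τ.part (P.procedure.error (ωs (Sum.inr (pos b)))) = e
      rw [hsame, herr, ErrorType.part_toPauli]
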